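/- For $\tau\in\mathbb{C}$ with $\operatorname{Im}\tau\neq0$ let $\wp(z)=\wp(z|2,2\tau)$ be the Weierstrass function with half-periods $(2,2\tau)$, that is, of the lattice $4\mathbb{Z}+4\tau\mathbb{Z}$, and let $$x(\tau)=\frac{\wp(1)-\wp(2)}{\wp(\tau)-\wp(2)}$$ be Burnside's function, which uniformizes the $x$-coordinate of the curve $y^2=x^5-x$. Write $x_\tau$ for the derivative and $\{x,\tau\}=\frac{x_{\tau\tau\tau}}{x_\tau}-\frac32\left(\frac{x_{\tau\tau}}{x_\tau}\right)^2$ for the Schwarzian derivative. Then for every $\tau$ with $\operatorname{Im}\tau\ne0$ one has $\wp(\tau)\neq\wp(2)$, $x$ is analytic at $\tau$ with $x_\tau\neq0$ and $x(\tau)\notin\{0,\pm1,\pm i\}$, and $x$ satisfies the Schwarz equation $$\frac{\{x,\tau\}}{x_\tau^2}=-\frac12\left\{\frac1{x^2}+\frac1{(x-1)^2}+\frac1{(x+1)^2}+\frac1{(x-i)^2}+\frac1{(x+i)^2}-\frac{4x^3}{x^5-x}\right\}.$$ Moreover all accessory parameters are zero: for $A_1,A_2,A_3\in\mathbb{C}$,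 the equation $$\frac{\{x,\tau\}}{x_\tau^2}=-\frac12\left\{\frac1{x^2}+\frac1{(x-1)^2}+\frac1{(x+1)^2}+\frac1{(x-i)^2}+\frac1{(x+i)^2}-\frac{4x^3+A_1x^2+A_2x+A_3}{x^5-x}\right\}$$ holds for all $\tau$ with $\operatorname{Im}\tau>0$ if and only if $A_1=A_2=A_3=0$. -/

import Mathlib

/-- For `Im τ ≠ 0`, the pair of full periods `(4, 4τ)`, i.e. the half-periods are `(2, 2τ)`. -/
def burnsidePeriods (τ : ℂ) (h : τ.im ≠ 0) : PeriodPair where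
  ω₁ := 2 * 2
  ω₂ := 2 * (2 * τ)
  indep := by
    rw [LinearIndependent.pair_iff]
    intro s t hst
    have him := congrArg Complex.im hst
    have hre := congrArg Complex.re hst
    simp at him hre
    have ht : t = 0 := by
      rcases him with h0 | h0
      · exact h0
      · exact absurd h0 h
    subst ht
    refine ⟨?_, rfl⟩
    simpa using hre

/-- The Weierstrass function `℘(z | 2, 2τ)` with half-periods `(2, 2τ)`, as a function of `τ` and
`z`. The value for real `τ`, where there is no lattice, is a placeholder. -/
noncomputable def burnsideP (τ z : ℂ) : ℂ :=
  if h : τ.im ≠ 0 then (burnsidePeriods τ h).weierstrassP z else 0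

/-- Burnside's uniformizing function `x(τ) = (℘(1) - ℘(2)) / (℘(τ) - ℘(2))`. -/
noncomputable def burnsideX (τ : ℂ) : ℂ :=
  (burnsideP τ 1 - burnsideP τ 2) / (burnsideP τ τ - burnsideP τ 2)

/-- The Schwarzian derivative `{f, z} = f'''/f' - (3/2) (f''/f')²`. -/
noncomputable def schwarzian (f : ℂ → ℂ) (z : ℂ) : ℂ :=
  iteratedDeriv 3 f z / deriv f z - 3 / 2 * (iteratedDeriv 2 f z / deriv f z) ^ 2

/-- The right-hand side of the Schwarz equation with parabolic singular points
`0, 1, -1, i, -i, ∞` and accessory parameters `A₁, A₂, A₃`. -/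
noncomputable def burnsideQ (A₁ A₂ A₃ x : ℂ) : ℂ :=
  -(1 / 2) * (1 / x ^ 2 + 1 / (x - 1) ^ 2 + 1 / (x + 1) ^ 2
    + 1 / (x - Complex.I) ^ 2 + 1 / (x + Complex.I) ^ 2
    - (4 * x ^ 3 + (A₁ * x ^ 2 + A₂ * x + A₃)) / (x ^ 5 - x))

/-!
The function `x` behaves like a modular function for the octahedral cover of level four, and the
Schwarz equation is an identity between modular forms of level one.

Translation by a half period `ω` acts on `℘` by `(℘ z - ℘ ω) (℘ (z + ω) - ℘ ω) = c` with a nonzero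
constant `c` (`PeriodPair.exists_weierstrassP_sub_mul_eq`, by Liouville's theorem). Evaluated at
quarter periods, this expresses the squares of `℘ 1 - ℘ 2`, `℘ τ - ℘ (2τ)` and
`℘ (τ + 1) - ℘ (2τ + 2)` through the differences of `e₁ = ℘ 2`, `e₂ = ℘ (2τ)`, `e₃ = ℘ (2τ + 2)`.
It follows that `x` omits the vertices `0, ±1, ±i, ∞` of an octahedron and that `τ ↦ τ + 1` and
`τ ↦ -1 / τ` act on `x` by rotations of it (`burnsideX_add_one`, `burnsideX_neg_one_div`).

Therefore the two forms `x' ^ 6 / (x ^ 5 - x) ^ 2` and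
`(x ^ 8 + 14 x ^ 4 + 1) x' ^ 2 / (x ^ 5 - x) ^ 2`, whose ingredients are invariant forms of the
octahedral group, are modular of weights `12` and `4` for the full modular group. Limits of `℘` at
`i∞` give `x ^ 2 → 1` (`tendsto_burnsideX_sq`), so `x` has an expansion in powers of
`exp (2πiτ / 4)` there. The form of weight `12` is then a nonzero cusp form, that is, a multiple of
the discriminant, which vanishes nowhere; this is why `x' ≠ 0` (`deriv_burnsideX_ne_zero`).
Its logarithmic derivative `L` is quasimodular of weight `2`, so that `L' - L ^ 2 / 12` is modular
of weight `4`. It has the same value at `i∞` as `-4 / 3` times the other form, and since there are no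
cusp forms of weight `4`, the two are equal (`deriv_logDeriv_burnsideDelta`). Written out in terms
of `x`, this equality is the Schwarz equation (`schwarzian_burnsideX`).

The lower half plane is covered by `x (-τ) = x τ`. The accessory parameters are unique because `x`
is not locally constant.
-/

/-! ### Translation of `℘` by a half period -/

open PeriodPair Filter Topology in
/-- Translation by a half period `ω` acts on `℘` by the involution
`℘ - ℘ ω ↦ c / (℘ - ℘ ω)` with a nonzero constant `c`. The product below has neither zeros nor
poles, because the double pole of one factor meets the double zero of the other one, so that
Liouville's theorem applies. -/
theorem PeriodPair.exists_weierstrassP_sub_mul_eq (L : PeriodPair) {ω : ℂ}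
    (hω : ω ∉ L.lattice) (h2 : ω + ω ∈ L.lattice) :
    ∃ c : ℂ, c ≠ 0 ∧ ∀ z, z ∉ L.lattice → z + ω ∉ L.lattice →
      (℘[L] z - ℘[L] ω) * (℘[L] (z + ω) - ℘[L] ω) = c := by
  classical
  have hper : ∀ z, ∀ l ∈ L.lattice, ℘[L] (z + l) = ℘[L] z := fun z l hl ↦
    L.weierstrassP_add_coe z ⟨l, hl⟩
  have hderiv : deriv ℘[L] ω = 0 := by
    rw [L.deriv_weierstrassP, ← CharZero.eq_neg_self_iff, ← L.derivWeierstrassP_neg]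
    have := L.derivWeierstrassP_add_coe (-ω) ⟨ω + ω, h2⟩
    simpa using this
  set w : ℂ → ℂ := fun z ↦ ℘[L] (z + ω) - ℘[L] ω with hw
  have hwa : AnalyticAt ℂ w 0 := by
    have h1 : AnalyticAt ℂ ℘[L] ((fun z : ℂ ↦ z + ω) 0) := by
      simpa using L.analyticOnNhd_weierstrassP ω hω
    exact (h1.comp (f := fun z : ℂ ↦ z + ω) (by fun_prop)).sub analyticAt_const
  have hw0 : w 0 = 0 := by simp [hw]
  have hdw0 : deriv w 0 = 0 := by
    simp only [hw, deriv_sub_const]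
    rw [deriv_comp_add_const, zero_add, hderiv]
  set k : ℂ → ℂ := dslope (dslope w 0) 0 with hk
  have hka : AnalyticAt ℂ k 0 := by
    obtain ⟨p, hp⟩ := hwa
    exact hp.has_fpower_series_dslope_fslope.has_fpower_series_dslope_fslope.analyticAt
  have hwk : ∀ z, w z = z ^ 2 * k z := by
    intro z
    have h1 := sub_smul_dslope w 0 z
    have h2 := sub_smul_dslope (dslope w 0) 0 z
    simp only [sub_zero, smul_eq_mul, hw0, dslope_same, hdw0] at h1 h2
    rw [← h1, ← h2]
    ring
  set H : ℂ → ℂ := fun z ↦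
    if z ∈ L.lattice ∨ z + ω ∈ L.lattice then k 0
    else (℘[L] z - ℘[L] ω) * (℘[L] (z + ω) - ℘[L] ω) with hH
  have hHper : ∀ z, ∀ l ∈ L.lattice, H (z + l) = H z := by
    intro z l hl
    simp only [hH, add_right_comm z l ω, hper _ l hl, L.lattice.add_mem_iff_left hl]
  have hHω : ∀ z, H (z + ω) = H z := by
    intro z
    simp only [hH, add_assoc z ω ω, hper _ _ h2, L.lattice.add_mem_iff_left h2,
      or_comm (a := z + ω ∈ L.lattice), mul_comm (℘[L] (z + ω) - ℘[L] ω)]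
  have hopen : ∀ᶠ z in 𝓝 (0 : ℂ), z + ω ∉ L.lattice := by
    have : ContinuousAt (fun z : ℂ ↦ z + ω) 0 := by fun_prop
    refine this.eventually (p := fun y ↦ y ∉ L.lattice) ?_
    simp only [zero_add]
    exact L.isClosed_lattice.isOpen_compl.mem_nhds hω
  set F : ℂ → ℂ := fun z ↦ z ^ 2 * ℘[L - (0 : ℂ)] z + 1 - ℘[L] ω * z ^ 2 with hF
  have hFa : AnalyticAt ℂ F 0 := by
    have := L.analyticAt_weierstrassPExcept 0
    simp only [hF]
    fun_prop
  have hH0 : H =ᶠ[𝓝 0] fun z ↦ F z * k z := by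
    filter_upwards [hopen, L.compl_lattice_sdiff_singleton_mem_nhds 0] with z hz hz'
    by_cases hz0 : z = 0
    · simp [hz0, hH, hF]
    have hzL : z ∉ L.lattice := fun h ↦ hz' ⟨h, hz0⟩
    have h1 := L.weierstrassPExcept_add ⟨0, zero_mem _⟩ z
    have h2 := hwk z
    simp only [hw] at h2
    simp only [hH, hzL, hz, or_self, if_false, h2, ← h1, hF]
    simp
    field_simp
  have hHa0 : AnalyticAt ℂ H 0 := (hFa.mul hka).congr hH0.symm
  have hHa : ∀ z, AnalyticAt ℂ H z := by
    intro z
    by_cases hz : z ∈ L.lattice ∨ z + ω ∈ L.lattice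
    · have hsub : H = fun y ↦ H (y - z) := by
        ext y
        rcases hz with hz | hz
        · rw [← hHper (y - z) _ hz, sub_add_cancel]
        · rw [← hHper (y - z) _ hz, ← add_assoc, sub_add_cancel, hHω]
      rw [hsub]
      have h1 : AnalyticAt ℂ H ((fun y : ℂ ↦ y - z) z) := by simpa using hHa0
      exact h1.comp (f := fun y : ℂ ↦ y - z) (by fun_prop)
    · push Not at hz
      have h1 : AnalyticAt ℂ ℘[L] ((fun y : ℂ ↦ y + ω) z) := L.analyticOnNhd_weierstrassP _ hz.2
      have h2 : AnalyticAt ℂ (fun y ↦ ℘[L] (y + ω)) z :=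
        h1.comp (f := fun y : ℂ ↦ y + ω) (by fun_prop)
      have h3 : AnalyticAt ℂ ℘[L] z := L.analyticOnNhd_weierstrassP _ hz.1
      refine ((h3.sub (analyticAt_const (v := ℘[L] ω))).mul
        (h2.sub (analyticAt_const (v := ℘[L] ω)))).congr ?_
      have h4 : ContinuousAt (fun y : ℂ ↦ y + ω) z := by fun_prop
      filter_upwards [L.isClosed_lattice.isOpen_compl.mem_nhds hz.1,
        h4.eventually (L.isClosed_lattice.isOpen_compl.mem_nhds hz.2)] with y hy hy'
      have hy1 : y ∉ L.lattice := hy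
      have hy2 : y + ω ∉ L.lattice := hy'
      simp [hH, hy1, hy2]
  have hdiff : Differentiable ℂ H := fun z ↦ (hHa z).differentiableAt
  have hconst : ∀ z, H z = H 0 := fun z ↦
    hdiff.apply_eq_apply_of_bounded (IsZLattice.isCompact_range_of_periodic L.lattice _
      hdiff.continuous fun z w hw ↦ hHper z w hw).isBounded z 0
  refine ⟨H 0, fun h0 ↦ ?_, fun z hz hz' ↦ by rw [← hconst z]; simp [hH, hz, hz']⟩
  -- If the constant were zero, `℘` would be constant near `ω`, hence everywhere.
  have hFne : ∀ᶠ z in 𝓝 (0 : ℂ), F z ≠ 0 :=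
    hFa.continuousAt.eventually_ne (by simp [hF])
  have hk0 : ∀ᶠ z in 𝓝 (0 : ℂ), w z = 0 := by
    filter_upwards [hH0, hFne] with z hz hFz
    rw [hconst z, h0] at hz
    have : k z = 0 := by simpa [hFz] using hz.symm
    rw [hwk, this, mul_zero]
  have hPω : ℘[L] =ᶠ[𝓝 ω] fun _ ↦ ℘[L] ω := by
    have h1 : ContinuousAt (fun z : ℂ ↦ z - ω) ω := by fun_prop
    have h2 := h1.eventually (p := fun z ↦ w z = 0) (by simpa using hk0)
    filter_upwards [h2] with z hz
    simpa [hw, sub_eq_zero] using hz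
  have hcount : (L.lattice : Set ℂ).Countable :=
    Set.countable_coe_iff.mp (inferInstanceAs (Countable L.lattice))
  have hconn : IsPreconnected (L.lattice : Set ℂ)ᶜ :=
    (hcount.isPathConnected_compl_of_one_lt_rank (by simp)).isConnected.isPreconnected
  have hall := L.analyticOnNhd_weierstrassP.eqOn_of_preconnected_of_eventuallyEq
    (analyticOnNhd_const (v := ℘[L] ω)) hconn hω hPω
  have hord := L.order_weierstrassP 0 (zero_mem _)
  have hev : ℘[L] =ᶠ[𝓝[≠] 0] fun _ ↦ ℘[L] ω := by
    filter_upwards [self_mem_nhdsWithin, mem_nhdsWithin_of_mem_nhds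
      (L.compl_lattice_sdiff_singleton_mem_nhds 0)] with z hz hz'
    exact hall fun h ↦ hz' ⟨h, hz⟩
  rw [meromorphicOrderAt_congr hev, meromorphicOrderAt_const] at hord
  split_ifs at hord
  · exact absurd hord (by decide)
  · exact absurd hord (by decide)

open PeriodPair in
/-- A half period is a critical point of `℘`, so its value is a root of `4 X ^ 3 - g₂ X - g₃`. -/
theorem PeriodPair.cubic_weierstrassP_half_period (L : PeriodPair) {ω : ℂ}
    (hω : ω ∉ L.lattice) (h2 : ω + ω ∈ L.lattice) :
    4 * ℘[L] ω ^ 3 - L.g₂ * ℘[L] ω - L.g₃ = 0 := by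
  have h0 : ℘'[L] ω = 0 := by
    rw [← CharZero.eq_neg_self_iff, ← L.derivWeierstrassP_neg]
    have := L.derivWeierstrassP_add_coe (-ω) ⟨ω + ω, h2⟩
    simpa using this
  rw [← L.derivWeierstrassP_sq ω hω, h0]
  simp

/-! ### The lattice functions `℘(z | 2, 2τ)` -/

theorem burnsideP_of_im_ne_zero {τ : ℂ} (h : τ.im ≠ 0) (z : ℂ) :
    burnsideP τ z = (burnsidePeriods τ h).weierstrassP z := by
  simp [burnsideP, h]

theorem mem_lattice_burnsidePeriods {τ : ℂ} (h : τ.im ≠ 0) {z : ℂ} :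
    z ∈ (burnsidePeriods τ h).lattice ↔ ∃ m n : ℤ, z = 4 * (m * τ + n) := by
  rw [PeriodPair.mem_lattice, exists_comm]
  refine exists_congr fun m ↦ exists_congr fun n ↦ ?_
  simp only [burnsidePeriods]
  rw [eq_comm (a := z)]
  ring_nf

/-- A point `u τ + v` with integral `u`, `v` lies in the lattice only if `4` divides `u` and `v`. -/
theorem int_mul_add_int_notMem_lattice {τ : ℂ} (h : τ.im ≠ 0) {u v : ℤ}
    (huv : ¬ (4 ∣ u ∧ 4 ∣ v)) : (u * τ + v : ℂ) ∉ (burnsidePeriods τ h).lattice := by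
  rw [mem_lattice_burnsidePeriods h]
  rintro ⟨m, n, hmn⟩
  have him := congrArg Complex.im hmn
  have hre := congrArg Complex.re hmn
  simp at him hre
  have h1 : (u : ℝ) = 4 * m := mul_right_cancel₀ h (by linarith)
  rw [h1] at hre
  have h2 : (v : ℝ) = 4 * n := by linarith
  exact huv ⟨⟨m, by exact_mod_cast h1⟩, ⟨n, by exact_mod_cast h2⟩⟩

/-- The summands of `℘(z | 2, 2τ)`, indexed so that `v` stands for the lattice point
`4 (v 0 τ + v 1)`. -/
noncomputable def burnsideTerm (z τ : ℂ) (v : Fin 2 → ℤ) : ℂ :=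
  1 / (z - 4 * (v 0 * τ + v 1)) ^ 2 - 1 / (4 * (v 0 * τ + v 1)) ^ 2

theorem hasSum_burnsideTerm {τ : ℂ} (h : τ.im ≠ 0) (z : ℂ) :
    HasSum (burnsideTerm z τ) (burnsideP τ z) := by
  rw [burnsideP_of_im_ne_zero h]
  have h1 := (burnsidePeriods τ h).hasSum_weierstrassP z
  let e : (Fin 2 → ℤ) ≃ (burnsidePeriods τ h).lattice :=
    (finTwoArrowEquiv ℤ).trans ((Equiv.prodComm ℤ ℤ).trans
      (burnsidePeriods τ h).latticeEquivProd.symm.toEquiv)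
  rw [← e.hasSum_iff] at h1
  convert h1 using 1
  ext v
  have : (e v : ℂ) = 4 * (v 0 * τ + v 1) := by
    have := (burnsidePeriods τ h).latticeEquiv_symm_apply (v 1, v 0)
    simp only [burnsidePeriods] at this
    refine this.trans ?_
    ring
  simp [burnsideTerm, this]

theorem burnsideP_neg (τ z : ℂ) : burnsideP τ (-z) = burnsideP τ z := by
  unfold burnsideP
  split_ifs
  · exact PeriodPair.weierstrassP_neg _ z
  · rfl

theorem burnsideP_add_period (τ z : ℂ) (m n : ℤ) :
    burnsideP τ (z + 4 * (m * τ + n)) = burnsideP τ z := by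
  unfold burnsideP
  split_ifs with h
  · exact (burnsidePeriods τ h).weierstrassP_add_coe z
      ⟨_, (mem_lattice_burnsidePeriods h).2 ⟨m, n, rfl⟩⟩
  · rfl

/-- The lattices of `τ + 1` and `τ` agree. -/
theorem burnsideP_add_one (τ z : ℂ) : burnsideP (τ + 1) z = burnsideP τ z := by
  by_cases h : τ.im = 0
  · simp [burnsideP, h]
  have h' : (τ + 1).im ≠ 0 := by simpa using h
  let e : (Fin 2 → ℤ) ≃ (Fin 2 → ℤ) :=
    { toFun := fun v ↦ ![v 0, v 0 + v 1]
      invFun := fun v ↦ ![v 0, v 1 - v 0]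
      left_inv := fun v ↦ by ext i; fin_cases i <;> simp
      right_inv := fun v ↦ by ext i; fin_cases i <;> simp }
  have h1 := hasSum_burnsideTerm h z
  rw [← e.hasSum_iff] at h1
  refine (hasSum_burnsideTerm h' z).unique ?_
  convert h1 using 1
  ext v
  simp only [burnsideTerm, Function.comp, e, Equiv.coe_fn_mk, Matrix.cons_val_zero,
    Matrix.cons_val_one]
  push_cast
  ring_nf

/-- The lattices of `-τ` and `τ` agree. -/
theorem burnsideP_neg_left (τ z : ℂ) : burnsideP (-τ) z = burnsideP τ z := by
  by_cases h : τ.im = 0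
  · simp [burnsideP, h]
  have h' : (-τ).im ≠ 0 := by simpa using h
  let e : (Fin 2 → ℤ) ≃ (Fin 2 → ℤ) :=
    { toFun := fun v ↦ ![-v 0, v 1]
      invFun := fun v ↦ ![-v 0, v 1]
      left_inv := fun v ↦ by ext i; fin_cases i <;> simp
      right_inv := fun v ↦ by ext i; fin_cases i <;> simp }
  have h1 := hasSum_burnsideTerm h z
  rw [← e.hasSum_iff] at h1
  refine (hasSum_burnsideTerm h' z).unique ?_
  convert h1 using 1
  ext v
  simp [burnsideTerm, e]

/-- The lattice of `-1 / τ` is the lattice of `τ` divided by `τ`. -/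
theorem burnsideP_neg_one_div {τ : ℂ} (h : τ.im ≠ 0) (z : ℂ) :
    burnsideP (-1 / τ) (z / τ) = τ ^ 2 * burnsideP τ z := by
  have h0 : τ ≠ 0 := by rintro rfl; simp at h
  have h' : (-1 / τ).im ≠ 0 := by
    simp [neg_div, Complex.inv_im, h, h0]
  let e : (Fin 2 → ℤ) ≃ (Fin 2 → ℤ) :=
    { toFun := fun v ↦ ![v 1, -v 0]
      invFun := fun v ↦ ![-v 1, v 0]
      left_inv := fun v ↦ by ext i; fin_cases i <;> simp
      right_inv := fun v ↦ by ext i; fin_cases i <;> simp }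
  have h1 := (hasSum_burnsideTerm h z).mul_left (τ ^ 2)
  rw [← e.hasSum_iff] at h1
  refine (hasSum_burnsideTerm h' (z / τ)).unique ?_
  have key : burnsideTerm (z / τ) (-1 / τ) = (fun i ↦ τ ^ 2 * burnsideTerm z τ i) ∘ e := by
    ext v
    simp only [burnsideTerm, Function.comp, e, Equiv.coe_fn_mk, Matrix.cons_val_zero,
      Matrix.cons_val_one]
    have e1 : z / τ - 4 * (v 0 * (-1 / τ) + v 1) = (z - 4 * (v 1 * τ + (-v 0 : ℤ))) / τ := by
      field_simp
      push_cast
      ring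
    have e2 : 4 * (v 0 * (-1 / τ) + v 1) = (4 * (v 1 * τ + (-v 0 : ℤ))) / τ := by
      field_simp
      push_cast
      ring
    rw [e1, e2, div_pow, div_pow, one_div_div, one_div_div, mul_sub, mul_one_div, mul_one_div]
  rwa [key]

/-- The product formula for translation by the half period `2 (uτ + v)`, evaluated at the points
`sτ + t` with integral `s`, `t`. -/
theorem exists_burnsideP_sub_mul_eq {τ : ℂ} (h : τ.im ≠ 0) (u v : ℤ)
    (huv : ¬ (2 ∣ u ∧ 2 ∣ v)) :
    ∃ c : ℂ, c ≠ 0 ∧ ∀ s t : ℤ, ¬ (4 ∣ s ∧ 4 ∣ t) → ¬ (4 ∣ s + 2 * u ∧ 4 ∣ t + 2 * v) →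
      (burnsideP τ (s * τ + t) - burnsideP τ (2 * (u * τ + v))) *
        (burnsideP τ ((s + 2 * u) * τ + (t + 2 * v)) - burnsideP τ (2 * (u * τ + v))) = c := by
  have hmem : (2 * (u * τ + v) : ℂ) ∉ (burnsidePeriods τ h).lattice := by
    have := int_mul_add_int_notMem_lattice h (u := 2 * u) (v := 2 * v) (by omega)
    push_cast at this
    convert this using 2
    ring
  have h2 : (2 * (u * τ + v) + 2 * (u * τ + v) : ℂ) ∈ (burnsidePeriods τ h).lattice :=
    (mem_lattice_burnsidePeriods h).2 ⟨u, v, by ring⟩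
  obtain ⟨c, hc, H⟩ := (burnsidePeriods τ h).exists_weierstrassP_sub_mul_eq hmem h2
  refine ⟨c, hc, fun s t hst hst' ↦ ?_⟩
  have h3 := int_mul_add_int_notMem_lattice h hst
  have h4 := int_mul_add_int_notMem_lattice h hst'
  have e : ((s + 2 * u) * τ + (t + 2 * v) : ℂ) = s * τ + t + 2 * (u * τ + v) := by ring
  push_cast at h4
  rw [e] at h4 ⊢
  simpa only [burnsideP_of_im_ne_zero h] using H _ h3 h4

/-! ### Algebraic relations and the modular action on `x` -/

/-- The difference `e₁ - e₂` of the values of `℘` at the half periods `2` and `2τ`. -/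
noncomputable def burnsideA (τ : ℂ) : ℂ := burnsideP τ 2 - burnsideP τ (2 * τ)

/-- The difference `e₁ - e₃` of the values of `℘` at the half periods `2` and `2τ + 2`. -/
noncomputable def burnsideB (τ : ℂ) : ℂ := burnsideP τ 2 - burnsideP τ (2 * τ + 2)

/-- The difference `℘ w - ℘ (2 w)` at the quarter period `w = uτ + v`. -/
noncomputable def burnsideQuarter (u v τ : ℂ) : ℂ :=
  burnsideP τ (u * τ + v) - burnsideP τ (2 * (u * τ + v))

section
variable {τ : ℂ}

/-- Translation by the half period `2w` fixes `℘ w`, because `℘ (3w) = ℘ (-w)`. So the product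
formula at the quarter period `w` is a square, and it is compared with its value at another half
period. -/
theorem burnsideQuarter_zero_one_sq (h : τ.im ≠ 0) :
    burnsideQuarter 0 1 τ ^ 2 = burnsideA τ * burnsideB τ ∧ burnsideA τ * burnsideB τ ≠ 0 := by
  obtain ⟨c, hc, H⟩ := exists_burnsideP_sub_mul_eq h 0 1 (by decide)
  have h1 := H 0 1 (by decide) (by decide)
  have h2 := H 2 0 (by decide) (by decide)
  have e1 : burnsideP τ (1 + 2) = burnsideP τ 1 := by
    have := burnsideP_add_period τ (-1) 0 1
    rw [burnsideP_neg] at this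
    rw [← this]
    norm_num
  norm_num [e1] at h1 h2
  norm_num [burnsideQuarter, burnsideA, burnsideB] at e1 ⊢
  rw [e1] at h1
  have h3 : (burnsideP τ 2 - burnsideP τ (2 * τ)) *
      (burnsideP τ 2 - burnsideP τ (2 * τ + 2)) = c := by
    rw [← h2]; ring
  refine ⟨by rw [h3, ← h1]; ring, mul_ne_zero_iff.1 (h3 ▸ hc)⟩

theorem burnsideQuarter_one_zero_sq (h : τ.im ≠ 0) :
    burnsideQuarter 1 0 τ ^ 2 = burnsideA τ * (burnsideA τ - burnsideB τ) ∧
      burnsideA τ * (burnsideA τ - burnsideB τ) ≠ 0 := by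
  obtain ⟨c, hc, H⟩ := exists_burnsideP_sub_mul_eq h 1 0 (by decide)
  have h1 := H 1 0 (by decide) (by decide)
  have h2 := H 0 2 (by decide) (by decide)
  have e1 : burnsideP τ (3 * τ) = burnsideP τ τ := by
    have := burnsideP_add_period τ (-τ) 1 0
    rw [burnsideP_neg] at this
    rw [← this]
    congr 1
    push_cast
    ring
  norm_num [e1] at h1 h2
  simp only [burnsideQuarter, burnsideA, burnsideB, one_mul, add_zero]
  have h3 : (burnsideP τ 2 - burnsideP τ (2 * τ)) * (burnsideP τ 2 - burnsideP τ (2 * τ) -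
      (burnsideP τ 2 - burnsideP τ (2 * τ + 2))) = c := by
    rw [← h2]; ring
  exact ⟨by rw [h3, ← h1]; ring, h3 ▸ hc⟩

theorem burnsideQuarter_one_one_sq (h : τ.im ≠ 0) :
    burnsideQuarter 1 1 τ ^ 2 = burnsideB τ * (burnsideB τ - burnsideA τ) := by
  obtain ⟨c, hc, H⟩ := exists_burnsideP_sub_mul_eq h 1 1 (by decide)
  have h1 := H 1 1 (by decide) (by decide)
  have h2 := H 0 2 (by decide) (by decide)
  have e1 : burnsideP τ (3 * τ + 3) = burnsideP τ (τ + 1) := by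
    have := burnsideP_add_period τ (-(τ + 1)) 1 1
    rw [burnsideP_neg] at this
    rw [← this]
    congr 1
    push_cast
    ring
  have e2 : burnsideP τ (2 * τ + 4) = burnsideP τ (2 * τ) := by
    have := burnsideP_add_period τ (2 * τ) 0 1
    rw [← this]
    congr 1
    push_cast
    ring
  norm_num [e1, e2, mul_add] at h1 h2
  simp only [burnsideQuarter, burnsideA, burnsideB, one_mul, mul_add, mul_one]
  rw [sq, h1, ← h2]
  ring

theorem burnsideA_ne_zero (h : τ.im ≠ 0) : burnsideA τ ≠ 0 :=
  left_ne_zero_of_mul (burnsideQuarter_zero_one_sq h).2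

theorem burnsideB_ne_zero (h : τ.im ≠ 0) : burnsideB τ ≠ 0 :=
  right_ne_zero_of_mul (burnsideQuarter_zero_one_sq h).2

theorem burnsideA_sub_burnsideB_ne_zero (h : τ.im ≠ 0) : burnsideA τ - burnsideB τ ≠ 0 :=
  right_ne_zero_of_mul (burnsideQuarter_one_zero_sq h).2

theorem burnsideQuarter_zero_one_ne_zero (h : τ.im ≠ 0) : burnsideQuarter 0 1 τ ≠ 0 := by
  rw [← pow_ne_zero_iff two_ne_zero, (burnsideQuarter_zero_one_sq h).1]
  exact (burnsideQuarter_zero_one_sq h).2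

theorem burnsideQuarter_one_zero_ne_zero (h : τ.im ≠ 0) : burnsideQuarter 1 0 τ ≠ 0 := by
  rw [← pow_ne_zero_iff two_ne_zero, (burnsideQuarter_one_zero_sq h).1]
  exact (burnsideQuarter_one_zero_sq h).2

/-- The three half-period values of `℘` add up to zero. -/
theorem burnsideA_add_burnsideB (h : τ.im ≠ 0) :
    burnsideA τ + burnsideB τ = 3 * burnsideP τ 2 := by
  have key : ∀ u v : ℤ, ¬ (2 ∣ u ∧ 2 ∣ v) →
      4 * burnsideP τ (2 * (u * τ + v)) ^ 3
        - (burnsidePeriods τ h).g₂ * burnsideP τ (2 * (u * τ + v)) - (burnsidePeriods τ h).g₃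
        = 0 := by
    intro u v huv
    rw [burnsideP_of_im_ne_zero h]
    refine (burnsidePeriods τ h).cubic_weierstrassP_half_period ?_
      ((mem_lattice_burnsidePeriods h).2 ⟨u, v, by ring⟩)
    have := int_mul_add_int_notMem_lattice h (u := 2 * u) (v := 2 * v) (by omega)
    push_cast at this
    convert this using 2
    ring
  have k1 := key 0 1 (by decide)
  have k2 := key 1 0 (by decide)
  have k3 := key 1 1 (by decide)
  norm_num [mul_add] at k1 k2 k3
  have hA := burnsideA_ne_zero h
  have hB := burnsideB_ne_zero h
  have hAB := burnsideA_sub_burnsideB_ne_zero h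
  unfold burnsideA burnsideB at *
  generalize burnsideP τ 2 = x at *
  generalize burnsideP τ (2 * τ) = y at *
  generalize burnsideP τ (2 * τ + 2) = z at *
  -- Divided differences of the cubic at its three distinct roots leave the sum of the roots.
  have : (x - y) * (x - z) * ((x - y) - (x - z)) * (4 * (x + y + z)) = 0 := by
    linear_combination (z - y) * k1 + (x - z) * k2 + (y - x) * k3
  have h0 := (mul_eq_zero.1 this).resolve_left (mul_ne_zero (mul_ne_zero hA hB) hAB)
  linear_combination -h0 / 4

theorem burnsideX_eq (τ : ℂ) :
    burnsideX τ = burnsideQuarter 0 1 τ / (burnsideQuarter 1 0 τ - burnsideA τ) := by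
  simp only [burnsideX, burnsideQuarter, burnsideA]
  norm_num

theorem burnsideQuarter_one_zero_sub_ne_zero (h : τ.im ≠ 0) :
    burnsideQuarter 1 0 τ - burnsideA τ ≠ 0 := by
  intro h0
  have h1 := (burnsideQuarter_one_zero_sq h).1
  rw [sub_eq_zero.1 h0] at h1
  exact (burnsideQuarter_zero_one_sq h).2 (by linear_combination h1)

theorem burnsideP_self_ne (h : τ.im ≠ 0) : burnsideP τ τ ≠ burnsideP τ 2 := by
  have := burnsideQuarter_one_zero_sub_ne_zero h
  intro h0
  apply this
  simp [burnsideQuarter, burnsideA, h0]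

theorem burnsideX_ne_zero (h : τ.im ≠ 0) : burnsideX τ ≠ 0 := by
  rw [burnsideX_eq]
  exact div_ne_zero (burnsideQuarter_zero_one_ne_zero h) (burnsideQuarter_one_zero_sub_ne_zero h)

/-- The modular function `4 (e₁ - e₂) / (e₁ - e₃)` equals `(x + 1 / x) ^ 2`. -/
theorem burnsideX_sq_add_one_sq (h : τ.im ≠ 0) :
    (burnsideX τ ^ 2 + 1) ^ 2 * burnsideB τ = 4 * burnsideX τ ^ 2 * burnsideA τ := by
  have h1 := (burnsideQuarter_zero_one_sq h).1
  have h2 := (burnsideQuarter_one_zero_sq h).1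
  have h3 := burnsideQuarter_one_zero_sub_ne_zero h
  rw [burnsideX_eq]
  generalize burnsideA τ = a at *
  generalize burnsideB τ = b at *
  generalize burnsideQuarter 0 1 τ = p at *
  generalize burnsideQuarter 1 0 τ = r at *
  have h4 : p ^ 2 + (r - a) ^ 2 = -2 * a * (r - a) := by linear_combination h1 + h2
  rw [div_pow, div_add_one (pow_ne_zero 2 h3), h4, div_pow, div_mul_eq_mul_div,
    mul_div_assoc', div_mul_eq_mul_div, div_eq_div_iff (by positivity) (by positivity), h1]
  ring

/-- The same for the modular function `4 (e₃ - e₂) / (e₁ - e₃)` and `(x - 1 / x) ^ 2`. -/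
theorem burnsideX_sq_sub_one_sq (h : τ.im ≠ 0) :
    (burnsideX τ ^ 2 - 1) ^ 2 * burnsideB τ =
      4 * burnsideX τ ^ 2 * (burnsideA τ - burnsideB τ) := by
  linear_combination burnsideX_sq_add_one_sq h

theorem burnsideX_sq_ne_one (h : τ.im ≠ 0) : burnsideX τ ^ 2 ≠ 1 := by
  intro h0
  have := burnsideX_sq_sub_one_sq h
  rw [h0] at this
  exact burnsideA_sub_burnsideB_ne_zero h (by linear_combination -this / 4)

theorem burnsideX_sq_ne_neg_one (h : τ.im ≠ 0) : burnsideX τ ^ 2 ≠ -1 := by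
  intro h0
  have := burnsideX_sq_add_one_sq h
  rw [h0] at this
  exact burnsideA_ne_zero h (by linear_combination this / 4)

/-- `x` omits the vertices of the octahedron. -/
theorem burnsideX_pow_five_sub_ne_zero (h : τ.im ≠ 0) : burnsideX τ ^ 5 - burnsideX τ ≠ 0 := by
  have : burnsideX τ ^ 5 - burnsideX τ =
      burnsideX τ * (burnsideX τ ^ 2 - 1) * (burnsideX τ ^ 2 - -1) := by ring
  rw [this]
  exact mul_ne_zero (mul_ne_zero (burnsideX_ne_zero h) (sub_ne_zero.2 (burnsideX_sq_ne_one h)))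
    (sub_ne_zero.2 (burnsideX_sq_ne_neg_one h))

theorem burnsideX_neg (τ : ℂ) : burnsideX (-τ) = burnsideX τ := by
  simp only [burnsideX, burnsideP_neg_left, burnsideP_neg]

theorem burnsideX_sub_one_ne_zero (h : τ.im ≠ 0) : burnsideX τ - 1 ≠ 0 := by
  intro h0
  exact burnsideX_sq_ne_one h (by rw [sub_eq_zero.1 h0]; norm_num)

/-- The inversion `τ ↦ -1 / τ` acts on `x` by a rotation of the octahedron. -/
theorem burnsideX_neg_one_div (h : τ.im ≠ 0) :
    burnsideX (-1 / τ) = (burnsideX τ + 1) / (burnsideX τ - 1) := by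
  have h0 : τ ≠ 0 := by rintro rfl; simp at h
  have e1 : burnsideP (-1 / τ) 1 = τ ^ 2 * burnsideP τ τ := by
    rw [← burnsideP_neg_one_div h, div_self h0]
  have e2 : burnsideP (-1 / τ) 2 = τ ^ 2 * burnsideP τ (2 * τ) := by
    rw [← burnsideP_neg_one_div h, mul_div_cancel_right₀ _ h0]
  have e3 : burnsideP (-1 / τ) (-1 / τ) = τ ^ 2 * burnsideP τ 1 := by
    rw [burnsideP_neg_one_div h, burnsideP_neg]
  have e4 : burnsideX (-1 / τ) =
      burnsideQuarter 1 0 τ / (burnsideQuarter 0 1 τ + burnsideA τ) := by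
    simp only [burnsideX, e1, e2, e3, ← mul_sub, burnsideQuarter, burnsideA]
    rw [mul_div_mul_left _ _ (pow_ne_zero 2 h0)]
    norm_num
  have h5 : burnsideQuarter 0 1 τ + burnsideA τ ≠ 0 := by
    have h' : (-1 / τ).im ≠ 0 := by simp [neg_div, Complex.inv_im, h, h0]
    intro h6
    have := burnsideX_ne_zero h'
    rw [e4, h6] at this
    simp at this
  have h1 := (burnsideQuarter_zero_one_sq h).1
  have h2 := (burnsideQuarter_one_zero_sq h).1
  have h3 := burnsideQuarter_one_zero_sub_ne_zero h
  have h6 := burnsideX_sub_one_ne_zero h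
  rw [e4, div_eq_div_iff h5 h6]
  rw [burnsideX_eq] at *
  generalize burnsideA τ = a at *
  generalize burnsideB τ = b at *
  generalize burnsideQuarter 0 1 τ = p at *
  generalize burnsideQuarter 1 0 τ = r at *
  rw [div_sub_one h3, div_add_one h3]
  field_simp
  linear_combination -h1 - h2

/-- The number `ε` through which `τ ↦ τ + 1` acts on `x`. Its square is `-1`; which of the two
square roots it is does not matter. -/
noncomputable def burnsideEps (τ : ℂ) : ℂ :=
  burnsideQuarter 1 1 τ * burnsideA τ / (burnsideQuarter 0 1 τ * burnsideQuarter 1 0 τ)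

theorem burnsideEps_sq (h : τ.im ≠ 0) : burnsideEps τ ^ 2 = -1 := by
  have h1 := burnsideQuarter_zero_one_sq h
  have h2 := burnsideQuarter_one_zero_sq h
  have h3 := burnsideQuarter_one_one_sq h
  rw [burnsideEps, div_pow, mul_pow, mul_pow, h1.1, h2.1, h3, div_eq_iff (mul_ne_zero h1.2 h2.2)]
  ring

theorem one_add_mul_burnsideX_ne_zero (h : τ.im ≠ 0) {ε : ℂ} (hε : ε ^ 2 = -1) :
    1 + ε * burnsideX τ ≠ 0 := by
  intro h0
  exact burnsideX_sq_ne_neg_one h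
    (by linear_combination burnsideX τ ^ 2 * hε + (1 - ε * burnsideX τ) * h0)

/-- The translation `τ ↦ τ + 1` acts on `x` by a rotation of the octahedron. -/
theorem burnsideX_add_one (h : τ.im ≠ 0) :
    burnsideX (τ + 1) =
      (burnsideX τ + burnsideEps τ) / (1 + burnsideEps τ * burnsideX τ) := by
  have h' : (τ + 1).im ≠ 0 := by simpa using h
  have e4 : burnsideX (τ + 1) =
      burnsideQuarter 0 1 τ / (burnsideQuarter 1 1 τ - burnsideB τ) := by
    simp only [burnsideX, burnsideP_add_one, burnsideQuarter, burnsideB]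
    norm_num [mul_add]
  have h5 : burnsideQuarter 1 1 τ - burnsideB τ ≠ 0 := by
    intro h6
    have := burnsideX_ne_zero h'
    rw [e4, h6] at this
    simp at this
  have hp := burnsideQuarter_zero_one_ne_zero h
  have hr := burnsideQuarter_one_zero_ne_zero h
  have ha := burnsideA_ne_zero h
  have hε := burnsideEps_sq h
  have hm : burnsideQuarter 1 1 τ * burnsideA τ =
      burnsideEps τ * burnsideQuarter 0 1 τ * burnsideQuarter 1 0 τ := by
    rw [burnsideEps]
    field_simp
  have h1 := (burnsideQuarter_zero_one_sq h).1
  have h2 := (burnsideQuarter_one_zero_sq h).1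
  have h3 := burnsideQuarter_one_zero_sub_ne_zero h
  have h6 := one_add_mul_burnsideX_ne_zero h hε
  rw [e4, div_eq_div_iff h5 h6]
  rw [burnsideX_eq] at *
  generalize burnsideA τ = a at *
  generalize burnsideB τ = b at *
  generalize burnsideQuarter 0 1 τ = p at *
  generalize burnsideQuarter 1 0 τ = r at *
  generalize burnsideQuarter 1 1 τ = m at *
  generalize burnsideEps τ = e at *
  field_simp
  refine mul_left_cancel₀ ha ?_
  linear_combination (p - (p + e * (r - a))) * h1 + p * h2 - (p + e * (r - a)) * hm -
    (r - a) * p * r * hε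

end

/-! ### Holomorphy in `τ` and limits at `i∞` -/

open Filter Topology UpperHalfPlane

theorem norm_le_norm_shift {c : ℤ} (hc : c = 1 ∨ c = 2) (v : Fin 2 → ℤ) :
    ‖v‖ ≤ ‖![-4 * v 0, c - 4 * v 1]‖ := by
  rw [EisensteinSeries.norm_eq_max_natAbs, EisensteinSeries.norm_eq_max_natAbs]
  simp only [Matrix.cons_val_zero, Matrix.cons_val_one]
  norm_cast
  apply max_le_max <;> omega

/-- A bound on the summands of `℘` at `1` and `2`, uniform on vertical strips. -/
theorem norm_burnsideTerm_le {A B : ℝ} (hB : 0 < B) {c : ℤ} (hc : c = 1 ∨ c = 2) {τ : ℂ}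
    (hA : |τ.re| ≤ A) (hτ : B ≤ τ.im) {v : Fin 2 → ℤ} (hv : v ≠ 0) :
    ‖burnsideTerm c τ v‖ ≤ 4 * EisensteinSeries.r ⟨⟨A, B⟩, hB⟩ ^ (-3 : ℝ) * ‖v‖ ^ (-3 : ℝ) := by
  set z : ℍ := ⟨τ, hB.trans_le hτ⟩ with hz
  set ρ : ℝ := EisensteinSeries.r ⟨⟨A, B⟩, hB⟩ with hρ
  have hρ0 : 0 < ρ := EisensteinSeries.r_pos _
  have hρz : ρ ≤ EisensteinSeries.r z :=
    EisensteinSeries.r_lower_bound_on_verticalStrip z hB ⟨hA, hτ⟩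
  have hrz : 0 ≤ EisensteinSeries.r z := (EisensteinSeries.r_pos z).le
  have hv0 : 0 < ‖v‖ := norm_pos_iff.2 hv
  have hshift := norm_le_norm_shift hc v
  set w₁ : ℂ := c - 4 * (v 0 * τ + v 1) with hw₁
  set w₂ : ℂ := 4 * (v 0 * τ + v 1) with hw₂
  have h1 : ρ * ‖v‖ ≤ ‖w₁‖ := by
    have hne : ![-4 * v 0, c - 4 * v 1] ≠ 0 := norm_pos_iff.1 (hv0.trans_le hshift)
    have := EisensteinSeries.r_mul_max_le z hne
    simp only [Matrix.cons_val_zero, Matrix.cons_val_one] at this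
    calc ρ * ‖v‖ ≤ EisensteinSeries.r z * ‖![-4 * v 0, c - 4 * v 1]‖ := by gcongr
      _ ≤ _ := this
      _ = ‖w₁‖ := by
        congr 1
        rw [hw₁]
        push_cast
        change _ * τ + _ = _
        ring
  have h2 : ρ * ‖v‖ ≤ ‖w₂‖ := by
    have h3 := EisensteinSeries.r_mul_max_le z hv
    calc ρ * ‖v‖ ≤ EisensteinSeries.r z * ‖v‖ := by gcongr
      _ ≤ ‖(v 0 * τ + v 1 : ℂ)‖ := h3
      _ ≤ 4 * ‖(v 0 * τ + v 1 : ℂ)‖ := by linarith [norm_nonneg (v 0 * τ + v 1 : ℂ)]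
      _ = ‖w₂‖ := by rw [hw₂, norm_mul]; simp
  have hpos : 0 < ρ * ‖v‖ := mul_pos hρ0 hv0
  have hw₁0 : w₁ ≠ 0 := norm_pos_iff.1 (hpos.trans_le h1)
  have hw₂0 : w₂ ≠ 0 := norm_pos_iff.1 (hpos.trans_le h2)
  have hcn : ‖(c : ℂ)‖ ≤ 2 := by rcases hc with rfl | rfl <;> norm_num
  have key : burnsideTerm c τ v = c * (1 / (w₁ ^ 2 * w₂) - 1 / (w₁ * w₂ ^ 2)) := by
    have hsum : (c : ℂ) = w₁ + w₂ := by rw [hw₁, hw₂]; ring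
    rw [burnsideTerm, ← hw₁, ← hw₂, hsum]
    field_simp
    ring
  have hb1 : ‖1 / (w₁ ^ 2 * w₂)‖ ≤ 1 / (ρ * ‖v‖) ^ 3 := by
    rw [norm_div, norm_one, norm_mul, norm_pow, pow_succ (ρ * ‖v‖) 2]
    gcongr
  have hb2 : ‖1 / (w₁ * w₂ ^ 2)‖ ≤ 1 / (ρ * ‖v‖) ^ 3 := by
    rw [norm_div, norm_one, norm_mul, norm_pow, pow_succ' (ρ * ‖v‖) 2]
    gcongr
  have hrp : ∀ x : ℝ, 0 < x → x ^ (-3 : ℝ) = 1 / x ^ 3 := fun x hx ↦ by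
    rw [Real.rpow_neg hx.le, one_div]
    norm_cast
  calc ‖burnsideTerm c τ v‖
      ≤ 2 * (1 / (ρ * ‖v‖) ^ 3 + 1 / (ρ * ‖v‖) ^ 3) := by
        rw [key, norm_mul]
        gcongr
        exact (norm_sub_le _ _).trans (add_le_add hb1 hb2)
    _ = _ := by
        rw [hrp ρ hρ0, hrp ‖v‖ hv0, mul_pow]
        field_simp
        ring

/-- The dominating series; the extra summand at `0` accounts for `‖0‖ ^ (-3) = 0`. -/
theorem summable_norm_rpow_add_single (C : ℝ) :
    Summable fun v : Fin 2 → ℤ ↦ C * ‖v‖ ^ (-3 : ℝ) + if v = 0 then 1 else 0 :=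
  ((EisensteinSeries.summable_one_div_norm_rpow (by norm_num)).mul_left C).add
    (summable_of_hasFiniteSupport ((Set.finite_singleton 0).subset (by simp)))

theorem norm_burnsideTerm_le' {A B : ℝ} (hB : 0 < B) {c : ℤ} (hc : c = 1 ∨ c = 2) {τ : ℂ}
    (hA : |τ.re| ≤ A) (hτ : B ≤ τ.im) (v : Fin 2 → ℤ) :
    ‖burnsideTerm c τ v‖ ≤ 4 * EisensteinSeries.r ⟨⟨A, B⟩, hB⟩ ^ (-3 : ℝ) * ‖v‖ ^ (-3 : ℝ) +
      if v = 0 then 1 else 0 := by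
  by_cases hv : v = 0
  · subst hv
    rcases hc with rfl | rfl <;> norm_num [burnsideTerm]
  · simpa [hv] using norm_burnsideTerm_le hB hc hA hτ hv

theorem differentiableAt_burnsideTerm {c : ℤ} (hc : c = 1 ∨ c = 2) {τ : ℂ} (hτ : 0 < τ.im)
    (v : Fin 2 → ℤ) : DifferentiableAt ℂ (fun τ ↦ burnsideTerm c τ v) τ := by
  by_cases hv : v = 0
  · subst hv
    simp [burnsideTerm]
  have h1 := int_mul_add_int_notMem_lattice hτ.ne' (u := -4 * v 0) (v := c - 4 * v 1) (by omega)
  have h2 : (v 0 * τ + v 1 : ℂ) ≠ 0 := by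
    have := EisensteinSeries.r_mul_max_le ⟨τ, hτ⟩ hv
    exact norm_pos_iff.1
      ((mul_pos (EisensteinSeries.r_pos _) (norm_pos_iff.2 hv)).trans_le this)
  have h3 : (c - 4 * (v 0 * τ + v 1) : ℂ) ≠ 0 := by
    intro h
    apply h1
    convert zero_mem (burnsidePeriods τ hτ.ne').lattice using 1
    rw [← h]
    push_cast
    ring
  unfold burnsideTerm
  refine .sub (.div (by fun_prop) (by fun_prop) (pow_ne_zero 2 h3))
    (.div (by fun_prop) (by fun_prop) (pow_ne_zero 2 (mul_ne_zero (by norm_num) h2)))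

/-- The values of `℘` at the points `1` and `2` are holomorphic functions of `τ`. -/
theorem differentiableAt_burnsideP {c : ℤ} (hc : c = 1 ∨ c = 2) {τ : ℂ} (hτ : 0 < τ.im) :
    DifferentiableAt ℂ (fun τ ↦ burnsideP τ c) τ := by
  set U : Set ℂ := {w | |w.re| < |τ.re| + 1} ∩ {w | τ.im / 2 < w.im} with hU
  have hUo : IsOpen U := by
    refine (isOpen_lt ?_ continuous_const).inter (isOpen_lt continuous_const Complex.continuous_im)
    exact Complex.continuous_re.abs
  have hτU : τ ∈ U := ⟨by simp, by simp [hτ]⟩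
  have hB : 0 < τ.im / 2 := by positivity
  have h1 : DifferentiableOn ℂ (fun w ↦ ∑' v, burnsideTerm c w v) U :=
    Complex.differentiableOn_tsum_of_summable_norm (summable_norm_rpow_add_single _)
      (fun v w hw ↦ (differentiableAt_burnsideTerm hc (hB.trans hw.2) v).differentiableWithinAt)
      hUo (fun v w hw ↦ norm_burnsideTerm_le' hB hc hw.1.le hw.2.le v)
  refine (h1.differentiableAt (hUo.mem_nhds hτU)).congr_of_eventuallyEq ?_
  filter_upwards [hUo.mem_nhds hτU] with w hw
  exact (hasSum_burnsideTerm (hB.trans hw.2).ne' c).tsum_eq.symm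

/-- A `1`-periodic function converges at `i∞` if it does so in the strip `|re τ| ≤ 1`. -/
theorem tendsto_comap_im_atTop_of_strip {f : ℂ → ℂ} {l : ℂ} (hf : ∀ τ, f (τ + 1) = f τ)
    (h : Tendsto f (comap Complex.im atTop ⊓ 𝓟 {τ | |τ.re| ≤ 1}) (𝓝 l)) :
    Tendsto f (comap Complex.im atTop) (𝓝 l) := by
  have hper : Function.Periodic f 1 := hf
  have hshift : ∀ τ, f (τ - round τ.re) = f τ := fun τ ↦ by
    simpa using hper.sub_int_mul_eq (x := τ) (round τ.re)
  have : Tendsto (fun τ : ℂ ↦ τ - (round τ.re : ℂ)) (comap Complex.im atTop)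
      (comap Complex.im atTop ⊓ 𝓟 {τ | |τ.re| ≤ 1}) := by
    refine tendsto_inf.2 ⟨?_, tendsto_principal.2 (Eventually.of_forall fun τ ↦ ?_)⟩
    · rw [tendsto_comap_iff]
      have : Complex.im ∘ (fun τ : ℂ ↦ τ - (round τ.re : ℂ)) = Complex.im := by
        ext τ; simp
      rw [this]
      exact tendsto_comap
    · have := abs_sub_round τ.re
      simp only [Set.mem_ofPred_eq, Complex.sub_re, Complex.intCast_re]
      linarith
  refine (h.comp this).congr fun τ ↦ hshift τ

theorem tendsto_burnsideTerm {c : ℤ} {v : Fin 2 → ℤ} (hv : v 0 ≠ 0) :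
    Tendsto (fun τ ↦ burnsideTerm c τ v) (comap Complex.im atTop) (𝓝 0) := by
  have key : ∀ a b d : ℝ, a ≠ 0 → Tendsto (fun τ : ℂ ↦ 1 / (b + a * (v 0 * τ + d)) ^ 2)
      (comap Complex.im atTop) (𝓝 0) := by
    intro a b d ha
    simp only [one_div]
    refine tendsto_inv₀_cobounded.comp ?_
    rw [← tendsto_norm_atTop_iff_cobounded]
    simp only [norm_pow]
    refine (tendsto_pow_atTop two_ne_zero).comp ?_
    have h1 : Tendsto (fun τ : ℂ ↦ |a * v 0| * τ.im) (comap Complex.im atTop) atTop :=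
      Tendsto.const_mul_atTop (by positivity) tendsto_comap
    refine tendsto_atTop_mono' _ ?_ h1
    filter_upwards [tendsto_comap.eventually (eventually_ge_atTop 0)] with τ hτ
    calc |a * v 0| * τ.im = |(b + a * (v 0 * τ + d) : ℂ).im| := by
          simp [abs_mul, abs_of_nonneg hτ, mul_assoc]
      _ ≤ _ := Complex.abs_im_le_norm _
  have h1 := key (-4) c (v 1) (by norm_num)
  have h2 := key 4 0 (v 1) (by norm_num)
  have := h1.sub h2
  rw [sub_zero] at this
  refine this.congr fun τ ↦ ?_
  simp only [burnsideTerm]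
  push_cast
  ring_nf

/-- Only the summands of the lattice points `4n` on the real axis survive at `i∞`. -/
theorem tendsto_burnsideP {c : ℤ} (hc : c = 1 ∨ c = 2) :
    Tendsto (fun τ ↦ burnsideP τ c) (comap Complex.im atTop)
      (𝓝 (∑' n : ℤ, (1 / (c - 4 * n : ℂ) ^ 2 - 1 / (4 * n : ℂ) ^ 2))) := by
  have hsum : ∑' n : ℤ, (1 / (c - 4 * n : ℂ) ^ 2 - 1 / (4 * n : ℂ) ^ 2) =
      ∑' v : Fin 2 → ℤ, if v 0 = 0 then burnsideTerm c 0 v else 0 := by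
    have hinj : Function.Injective (fun n : ℤ ↦ (![0, n] : Fin 2 → ℤ)) := fun a b hab ↦ by
      simpa using congrFun hab 1
    rw [← hinj.tsum_eq]
    · simp [burnsideTerm]
    · intro v hv
      have : v 0 = 0 := by
        by_contra h
        simp [h] at hv
      refine ⟨v 1, ?_⟩
      ext i
      fin_cases i <;> simp [this]
  rw [hsum]
  refine tendsto_comap_im_atTop_of_strip (fun τ ↦ burnsideP_add_one τ c) ?_
  have h1 : Tendsto (fun τ ↦ ∑' v, burnsideTerm c τ v)
      (comap Complex.im atTop ⊓ 𝓟 {τ | |τ.re| ≤ 1})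
      (𝓝 (∑' v : Fin 2 → ℤ, if v 0 = 0 then burnsideTerm c 0 v else 0)) := by
    refine tendsto_tsum_of_dominated_convergence
      (summable_norm_rpow_add_single (4 * EisensteinSeries.r ⟨⟨1, 1⟩, one_pos⟩ ^ (-3 : ℝ)))
      (fun v ↦ ?_) ?_
    · split_ifs with hv
      · refine tendsto_const_nhds.congr fun τ ↦ ?_
        simp [burnsideTerm, hv]
      · exact (tendsto_burnsideTerm hv).mono_left inf_le_left
    · refine eventually_inf_principal.2 ?_
      filter_upwards [tendsto_comap.eventually (eventually_ge_atTop 1)] with τ hτ hre v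
      exact norm_burnsideTerm_le' one_pos hc hre hτ v
  refine h1.congr' (Filter.mem_of_superset (mem_inf_of_left
    (tendsto_comap.eventually (eventually_gt_atTop 0))) fun τ hτ ↦ ?_)
  exact (hasSum_burnsideTerm (ne_of_gt hτ) c).tsum_eq

theorem tsum_int_eq_sum_residues {f : ℤ → ℂ} (hf : Summable f) (N : ℕ) [NeZero N] :
    ∑' n, f n = ∑ j : Fin N, ∑' q : ℤ, f (q * N + j) := by
  rw [← (Int.divModEquiv N).symm.tsum_eq, ← (Equiv.prodComm _ _).tsum_eq]
  have h1 := (Equiv.prodComm (Fin N) ℤ).summable_iff.2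
    ((Int.divModEquiv N).symm.summable_iff.2 hf)
  have h2 := h1.tsum_prod
  simp only [Function.comp] at h2
  rw [h2, tsum_fintype]
  simp

theorem summable_one_div_int_sq : Summable fun n : ℤ ↦ 1 / (n : ℂ) ^ 2 := by
  have := Real.summable_one_div_int_pow.2 (one_lt_two : 1 < 2)
  refine .of_norm (this.congr fun n ↦ ?_)
  simp

/-- The sums of `1 / n ^ 2` over the residue classes modulo `4` are in the proportion
`1 : 6 : 3 : 6`, where the class of `0` comes first and its term `n = 0` is `0` by the convention
`1 / 0 = 0`. -/
theorem exists_tsum_residues_mod_four : ∃ T : ℂ, T ≠ 0 ∧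
    ∑' n : ℤ, 1 / (4 * n : ℂ) ^ 2 = T ∧ ∑' n : ℤ, 1 / (1 - 4 * n : ℂ) ^ 2 = 6 * T ∧
    ∑' n : ℤ, 1 / (2 - 4 * n : ℂ) ^ 2 = 3 * T := by
  set Z : ℂ := ∑' n : ℤ, 1 / (n : ℂ) ^ 2 with hZ
  have hZ0 : Z ≠ 0 := by
    have := two_mul_riemannZeta_eq_tsum_int_inv_pow_of_even (k := 2) le_rfl even_two
    simp only [hZ, one_div]
    rw [← this]
    push_cast
    rw [riemannZeta_two]
    simp [Real.pi_ne_zero]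
  have h4 : ∀ k : ℂ, ∑' n : ℤ, 1 / (k * n : ℂ) ^ 2 = Z / k ^ 2 := fun k ↦ by
    rw [hZ, ← tsum_div_const]
    refine tsum_congr fun n ↦ ?_
    rw [mul_pow, div_div, mul_comm]
  have hS2 : Summable fun n : ℤ ↦ 1 / (2 * n : ℂ) ^ 2 := by
    refine (summable_one_div_int_sq.div_const 4).congr fun n ↦ ?_
    rw [mul_pow, div_div, mul_comm]
    norm_num
  set S : ℂ → ℂ := fun j ↦ ∑' q : ℤ, 1 / (q * 4 + j : ℂ) ^ 2 with hS
  have d4 : Z = S 0 + S 1 + S 2 + S 3 := by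
    have := tsum_int_eq_sum_residues summable_one_div_int_sq 4
    simpa [Fin.sum_univ_four, hS, hZ] using this
  have d2 : Z / 4 = S 0 + S 2 := by
    have := tsum_int_eq_sum_residues hS2 2
    rw [h4, Fin.sum_univ_two] at this
    norm_num at this
    rw [this]
    simp only [hS, one_div]
    congr 1 <;> refine tsum_congr fun q ↦ ?_
    · ring_nf
    · ring_nf
  have h0 : ∑' n : ℤ, 1 / (4 * n : ℂ) ^ 2 = S 0 :=
    tsum_congr fun n ↦ by rw [add_zero, mul_comm]
  have hneg : ∀ j : ℂ, ∑' n : ℤ, 1 / (j - 4 * n : ℂ) ^ 2 = S j := fun j ↦ by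
    rw [hS, ← (Equiv.neg ℤ).tsum_eq]
    refine tsum_congr fun n ↦ ?_
    simp only [Equiv.neg_apply]
    push_cast
    ring_nf
  have h13 : S 3 = S 1 := by
    simp only [hS]
    rw [← (Equiv.subLeft (-1 : ℤ)).tsum_eq]
    refine tsum_congr fun n ↦ ?_
    simp only [Equiv.subLeft_apply]
    push_cast
    ring_nf
  have h0' : S 0 = Z / 16 := by rw [← h0, h4]; norm_num
  refine ⟨Z / 16, by simpa using hZ0, by rw [h0, h0'], ?_, ?_⟩
  · rw [hneg]
    linear_combination -d4 / 2 - h13 / 2 + d2 / 2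
  · rw [hneg]
    linear_combination -h0' - d2

/-- Both `e₁ - e₂` and `e₁ - e₃` tend to the same nonzero limit at `i∞`; the statement
gives their sum `3 ℘ 2` and the square root `℘ 1 - ℘ 2` of their product. -/
theorem exists_tendsto_burnsideP : ∃ T : ℂ, T ≠ 0 ∧
    Tendsto (fun τ ↦ burnsideP τ 1 - burnsideP τ 2) (comap Complex.im atTop) (𝓝 (3 * T)) ∧
    Tendsto (fun τ ↦ burnsideP τ 2) (comap Complex.im atTop) (𝓝 (2 * T)) := by
  obtain ⟨T, hT, h0, h1, h2⟩ := exists_tsum_residues_mod_four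
  have hsub : ∀ c : ℤ, c = 1 ∨ c = 2 →
      ∑' n : ℤ, (1 / (c - 4 * n : ℂ) ^ 2 - 1 / (4 * n : ℂ) ^ 2) =
        ∑' n : ℤ, 1 / (c - 4 * n : ℂ) ^ 2 - ∑' n : ℤ, 1 / (4 * n : ℂ) ^ 2 := by
    intro c hc
    refine Summable.tsum_sub ?_ ?_
    · refine (summable_one_div_int_sq.comp_injective (i := fun n : ℤ ↦ c - 4 * n)
        fun a b hab ↦ ?_).congr fun n ↦ ?_
      · simp only at hab; omega
      · simp
    · refine (summable_one_div_int_sq.comp_injective (i := fun n : ℤ ↦ 4 * n)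
        fun a b hab ↦ ?_).congr fun n ↦ ?_
      · simp only at hab; omega
      · simp
  have t1 := tendsto_burnsideP (c := 1) (Or.inl rfl)
  have t2 := tendsto_burnsideP (c := 2) (Or.inr rfl)
  rw [hsub 1 (Or.inl rfl)] at t1
  rw [hsub 2 (Or.inr rfl)] at t2
  push_cast at t1 t2
  rw [h0, h1] at t1
  rw [h0, h2] at t2
  refine ⟨T, hT, ?_, ?_⟩
  · convert t1.sub t2 using 2
    ring
  · convert t2 using 2
    ring

/-! ### The function `x` on the upper half plane -/

theorem ne_zero_of_im_pos {τ : ℂ} (hτ : 0 < τ.im) : τ ≠ 0 := by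
  rintro rfl
  simp at hτ

theorem neg_one_div_im_pos {τ : ℂ} (hτ : 0 < τ.im) : 0 < (-1 / τ).im := by
  simpa [neg_div, Complex.inv_im] using
    div_pos hτ (Complex.normSq_pos.2 (ne_zero_of_im_pos hτ))

section
variable {τ : ℂ}

/-- The points `τ` and `2τ` become `1` and `2` under `τ ↦ -1 / τ`. -/
theorem differentiableAt_burnsideP_mul_self {c : ℤ} (hc : c = 1 ∨ c = 2) (hτ : 0 < τ.im) :
    DifferentiableAt ℂ (fun τ ↦ burnsideP τ (c * τ)) τ := by
  have h0 := ne_zero_of_im_pos hτ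
  have h1 : 0 < ((fun τ : ℂ ↦ -1 / τ) τ).im := neg_one_div_im_pos hτ
  have h2 : DifferentiableAt ℂ (fun τ ↦ burnsideP (-1 / τ) c / τ ^ 2) τ :=
    ((differentiableAt_burnsideP hc h1).comp τ (f := fun τ : ℂ ↦ -1 / τ)
      (by fun_prop (disch := exact h0))).div (by fun_prop) (pow_ne_zero 2 h0)
  refine h2.congr_of_eventuallyEq ?_
  filter_upwards [isOpen_upperHalfPlaneSet.mem_nhds hτ] with w hw
  have hw0 : w ≠ 0 := ne_zero_of_im_pos hw
  have := burnsideP_neg_one_div (ne_of_gt hw) (c * w)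
  rw [mul_div_cancel_right₀ _ hw0] at this
  rw [this, mul_div_cancel_left₀ _ (pow_ne_zero 2 hw0)]

/-- The points `τ + 1` and `2τ + 2` belong to `τ + 1` as `τ` and `2τ` do to `τ`. -/
theorem differentiableAt_burnsideP_mul_add {c : ℤ} (hc : c = 1 ∨ c = 2) (hτ : 0 < τ.im) :
    DifferentiableAt ℂ (fun τ ↦ burnsideP τ (c * (τ + 1))) τ := by
  have h1 : 0 < ((fun τ : ℂ ↦ τ + 1) τ).im := by simpa using hτ
  have := (differentiableAt_burnsideP_mul_self hc h1).comp τ (f := fun τ : ℂ ↦ τ + 1)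
    (by fun_prop)
  simpa only [Function.comp_def, burnsideP_add_one] using this

theorem differentiableAt_burnsideA (hτ : 0 < τ.im) : DifferentiableAt ℂ burnsideA τ :=
  (differentiableAt_burnsideP (c := 2) (Or.inr rfl) hτ).sub
    (differentiableAt_burnsideP_mul_self (c := 2) (Or.inr rfl) hτ)

theorem differentiableAt_burnsideQuarter_zero_one (hτ : 0 < τ.im) :
    DifferentiableAt ℂ (burnsideQuarter 0 1) τ := by
  have := (differentiableAt_burnsideP (c := 1) (Or.inl rfl) hτ).sub
    (differentiableAt_burnsideP (c := 2) (Or.inr rfl) hτ)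
  refine this.congr_of_eventuallyEq (Eventually.of_forall fun w ↦ ?_)
  simp [burnsideQuarter]

theorem differentiableAt_burnsideQuarter_one_zero (hτ : 0 < τ.im) :
    DifferentiableAt ℂ (burnsideQuarter 1 0) τ := by
  have := (differentiableAt_burnsideP_mul_self (c := 1) (Or.inl rfl) hτ).sub
    (differentiableAt_burnsideP_mul_self (c := 2) (Or.inr rfl) hτ)
  refine this.congr_of_eventuallyEq (Eventually.of_forall fun w ↦ ?_)
  simp [burnsideQuarter]

theorem differentiableAt_burnsideQuarter_one_one (hτ : 0 < τ.im) :
    DifferentiableAt ℂ (burnsideQuarter 1 1) τ := by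
  have := (differentiableAt_burnsideP_mul_add (c := 1) (Or.inl rfl) hτ).sub
    (differentiableAt_burnsideP_mul_add (c := 2) (Or.inr rfl) hτ)
  refine this.congr_of_eventuallyEq (Eventually.of_forall fun w ↦ ?_)
  simp [burnsideQuarter]

theorem differentiableAt_burnsideX (hτ : 0 < τ.im) : DifferentiableAt ℂ burnsideX τ := by
  have : burnsideX = fun τ ↦ burnsideQuarter 0 1 τ / (burnsideQuarter 1 0 τ - burnsideA τ) :=
    funext burnsideX_eq
  rw [this]
  exact (differentiableAt_burnsideQuarter_zero_one hτ).div
    ((differentiableAt_burnsideQuarter_one_zero hτ).sub (differentiableAt_burnsideA hτ))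
    (burnsideQuarter_one_zero_sub_ne_zero hτ.ne')

theorem analyticAt_burnsideX (hτ : 0 < τ.im) : AnalyticAt ℂ burnsideX τ :=
  DifferentiableOn.analyticAt (s := upperHalfPlaneSet)
    (fun _ hw ↦ (differentiableAt_burnsideX hw).differentiableWithinAt)
    (isOpen_upperHalfPlaneSet.mem_nhds hτ)

theorem differentiableAt_burnsideEps (hτ : 0 < τ.im) : DifferentiableAt ℂ burnsideEps τ :=
  ((differentiableAt_burnsideQuarter_one_one hτ).mul (differentiableAt_burnsideA hτ)).div
    ((differentiableAt_burnsideQuarter_zero_one hτ).mul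
      (differentiableAt_burnsideQuarter_one_zero hτ))
    (mul_ne_zero (burnsideQuarter_zero_one_ne_zero hτ.ne')
      (burnsideQuarter_one_zero_ne_zero hτ.ne'))

end

/-- The square root `ε` of `-1` in the law for `τ ↦ τ + 1` is the same on the upper half plane. -/
theorem exists_burnsideX_add_one : ∃ ε : ℂ, ε ^ 2 = -1 ∧ ∀ τ : ℂ, 0 < τ.im →
    burnsideX (τ + 1) = (burnsideX τ + ε) / (1 + ε * burnsideX τ) := by
  have hI : Complex.I ∈ upperHalfPlaneSet := by simp
  refine ⟨burnsideEps Complex.I, burnsideEps_sq hI.ne', fun τ hτ ↦ ?_⟩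
  rw [burnsideX_add_one hτ.ne']
  have hpre : IsPreconnected upperHalfPlaneSet := (convex_halfSpace_im_gt 0).isPreconnected
  have : burnsideEps τ = burnsideEps Complex.I := by
    refine isOpen_upperHalfPlaneSet.is_const_of_deriv_eq_zero hpre
      (fun w hw ↦ (differentiableAt_burnsideEps hw).differentiableWithinAt) (fun w hw ↦ ?_) hτ hI
    have h1 : HasDerivAt (fun w ↦ burnsideEps w ^ 2) _ w :=
      (differentiableAt_burnsideEps hw).hasDerivAt.pow 2
    have h2 : (fun w ↦ burnsideEps w ^ 2) =ᶠ[𝓝 w] fun _ ↦ -1 := by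
      filter_upwards [isOpen_upperHalfPlaneSet.mem_nhds hw] with v hv
      exact burnsideEps_sq (ne_of_gt hv)
    have h3 := h1.unique ((hasDerivAt_const w (-1 : ℂ)).congr_of_eventuallyEq h2)
    have h4 : burnsideEps w ≠ 0 := by
      intro h
      have := burnsideEps_sq (ne_of_gt hw)
      rw [h] at this
      norm_num at this
    simpa [h4] using h3
  rw [this]

theorem burnsideX_add_four (τ : ℂ) : burnsideX (τ + 4) = burnsideX τ := by
  have h1 : ∀ z, burnsideP (τ + 4) z = burnsideP τ z := fun z ↦ by
    rw [show τ + 4 = τ + 1 + 1 + 1 + 1 by ring]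
    simp only [burnsideP_add_one]
  have h2 : burnsideP τ (τ + 4) = burnsideP τ τ := by
    rw [← burnsideP_add_period τ τ 0 1]
    norm_num
  simp only [burnsideX, h1, h2]

instance : (comap Complex.im atTop).NeBot := atTop_neBot.comap_of_surj Complex.im_surjective

theorem eventually_comap_im_pos : ∀ᶠ τ : ℂ in comap Complex.im atTop, 0 < τ.im :=
  tendsto_comap.eventually (eventually_gt_atTop 0)

/-- `x ^ 2 → 1` at `i∞`, because `(x ^ 2 - 1) ^ 2 = 4 x ^ 2 (a - b) / b` for `a = e₁ - e₂` and
`b = e₁ - e₃`, where `a` and `b` have the same nonzero limit. -/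
theorem tendsto_burnsideX_sq :
    Tendsto (fun τ ↦ burnsideX τ ^ 2) (comap Complex.im atTop) (𝓝 1) := by
  obtain ⟨T, hT, h1, h2⟩ := exists_tendsto_burnsideP
  have hadd : Tendsto (fun τ ↦ burnsideA τ + burnsideB τ) (comap Complex.im atTop)
      (𝓝 (6 * T)) := by
    have := h2.const_mul 3
    rw [← mul_assoc] at this
    norm_num at this
    refine this.congr' ?_
    filter_upwards [eventually_comap_im_pos] with τ hτ
    rw [burnsideA_add_burnsideB hτ.ne']
  have hmul : Tendsto (fun τ ↦ burnsideA τ * burnsideB τ) (comap Complex.im atTop)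
      (𝓝 ((3 * T) ^ 2)) := by
    refine (h1.pow 2).congr' ?_
    filter_upwards [eventually_comap_im_pos] with τ hτ
    rw [← (burnsideQuarter_zero_one_sq hτ.ne').1]
    simp [burnsideQuarter]
  have hsub : Tendsto (fun τ ↦ burnsideA τ - burnsideB τ) (comap Complex.im atTop) (𝓝 0) := by
    have h3 : Tendsto (fun τ ↦ (burnsideA τ - burnsideB τ) ^ 2) (comap Complex.im atTop)
        (𝓝 0) := by
      have := (hadd.pow 2).sub (hmul.const_mul 4)
      rw [show (6 * T) ^ 2 - 4 * (3 * T) ^ 2 = 0 by ring] at this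
      refine this.congr fun τ ↦ ?_
      ring
    rw [tendsto_zero_iff_norm_tendsto_zero] at h3 ⊢
    have h4 := (Real.continuous_sqrt.tendsto 0).comp h3
    simpa [Function.comp_def, Real.sqrt_sq] using h4
  have hb : Tendsto burnsideB (comap Complex.im atTop) (𝓝 (3 * T)) := by
    have := (hadd.sub hsub).div_const 2
    rw [show (6 * T - 0) / 2 = 3 * T by ring] at this
    refine this.congr fun τ ↦ ?_
    ring
  have hδ : Tendsto (fun τ ↦ ‖(burnsideA τ - burnsideB τ) / burnsideB τ‖)
      (comap Complex.im atTop) (𝓝 0) := by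
    have := (hsub.div hb (by simpa using hT)).norm
    simpa using this
  -- The relation bounds `‖x ^ 2 - 1‖` before it forces it to zero: it is quadratic on the left
  -- and only linear in `x ^ 2` on the right.
  rw [tendsto_iff_norm_sub_tendsto_zero]
  have hsq : Tendsto (fun τ ↦ ‖burnsideX τ ^ 2 - 1‖ ^ 2) (comap Complex.im atTop) (𝓝 0) := by
    have h5 := hδ.const_mul 12
    rw [mul_zero] at h5
    refine squeeze_zero' (Eventually.of_forall fun τ ↦ by positivity) ?_ h5
    filter_upwards [eventually_comap_im_pos,
      hδ.eventually (eventually_le_nhds (show (0 : ℝ) < 1 / 4 by norm_num))] with τ hτ hle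
    have hbn := burnsideB_ne_zero hτ.ne'
    have key : (burnsideX τ ^ 2 - 1) ^ 2 =
        4 * burnsideX τ ^ 2 * ((burnsideA τ - burnsideB τ) / burnsideB τ) := by
      rw [mul_div_assoc', eq_div_iff hbn]
      exact burnsideX_sq_sub_one_sq hτ.ne'
    have key2 := congrArg norm key
    simp only [norm_mul, norm_pow] at key2
    rw [← norm_pow (burnsideX τ) 2] at key2
    norm_num at key2
    have h6 : ‖burnsideX τ ^ 2‖ ≤ ‖burnsideX τ ^ 2 - 1‖ + 1 := by
      have := norm_add_le (burnsideX τ ^ 2 - 1) 1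
      simpa using this
    rw [norm_pow (burnsideX τ) 2] at h6
    rw [norm_div] at hle ⊢
    set d := ‖burnsideA τ - burnsideB τ‖ / ‖burnsideB τ‖
    have hd0 : 0 ≤ d := by positivity
    set Y := ‖burnsideX τ‖ ^ 2
    have hY : 0 ≤ Y := by positivity
    set N := ‖burnsideX τ ^ 2 - 1‖
    have hN : 0 ≤ N := norm_nonneg _
    have h7 : N ^ 2 ≤ Y := by rw [key2]; nlinarith
    have h8 : N ≤ 2 := by nlinarith
    rw [key2]
    nlinarith
  have h9 := (Real.continuous_sqrt.tendsto 0).comp hsq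
  simpa [Function.comp_def, Real.sqrt_sq] using h9

/-! ### Leading terms at `i∞` -/

/-- A property that holds at `i∞` also holds in a neighbourhood of every point near `i∞`. -/
theorem eventually_eventually_nhds_comap_im {P : ℂ → Prop}
    (h : ∀ᶠ τ in comap Complex.im atTop, P τ) :
    ∀ᶠ τ in comap Complex.im atTop, ∀ᶠ w in 𝓝 τ, P w := by
  obtain ⟨A, -, hA⟩ := (atTop_basis.comap Complex.im).eventually_iff.1 h
  filter_upwards [tendsto_comap.eventually (eventually_gt_atTop A)] with τ hτ
  filter_upwards [(isOpen_lt continuous_const Complex.continuous_im).mem_nhds hτ] with w hw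
  exact hA (show A ≤ w.im from le_of_lt hw)

/-- By Cauchy's estimate on discs of radius one. -/
theorem tendsto_deriv_comap_im {F : ℂ → ℂ} {c : ℂ}
    (hF : Tendsto F (comap Complex.im atTop) (𝓝 c))
    (hd : ∀ᶠ τ in comap Complex.im atTop, DifferentiableAt ℂ F τ) :
    Tendsto (deriv F) (comap Complex.im atTop) (𝓝 0) := by
  rw [Metric.tendsto_nhds]
  intro δ hδ
  have h1 := (Metric.tendsto_nhds.1 hF (δ / 2) (half_pos hδ)).and hd
  obtain ⟨A, -, hA⟩ := (atTop_basis.comap Complex.im).eventually_iff.1 h1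
  filter_upwards [tendsto_comap.eventually (eventually_ge_atTop (A + 1))] with τ hτ
  have hball : ∀ w ∈ Metric.closedBall τ 1, A ≤ w.im := fun w hw ↦ by
    have h2 := (Complex.abs_im_le_norm (w - τ)).trans (by simpa [dist_eq_norm] using hw)
    rw [Complex.sub_im, abs_le] at h2
    linarith
  have h3 : ‖deriv (fun w ↦ F w - c) τ‖ ≤ δ / 2 / 1 := by
    refine Complex.norm_deriv_le_of_forall_mem_sphere_norm_le one_pos ?_ fun w hw ↦ ?_
    · refine DifferentiableOn.diffContOnCl_ball (U := Metric.closedBall τ 1)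
        (fun w hw ↦ ?_) subset_rfl
      exact ((hA (hball w hw)).2.sub_const c).differentiableWithinAt
    · have := (hA (hball w (Metric.sphere_subset_closedBall hw))).1
      rw [dist_eq_norm] at this
      exact this.le
  rw [deriv_sub_const, div_one] at h3
  rw [dist_zero_right]
  linarith

/-- `HasLeadingTerm F a c` says that `F τ ~ c * exp (a * τ)` at `i∞`, with a quotient
`F τ * exp (-a * τ)` that is holomorphic near `i∞`. -/
def HasLeadingTerm (F : ℂ → ℂ) (a c : ℂ) : Prop :=
  ∃ R : ℂ → ℂ, Tendsto R (comap Complex.im atTop) (𝓝 c) ∧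
    ∀ᶠ τ in comap Complex.im atTop, DifferentiableAt ℂ R τ ∧ F τ = Complex.exp (a * τ) * R τ

namespace HasLeadingTerm

variable {F G : ℂ → ℂ} {a b c d : ℂ}

theorem of_tendsto (hF : Tendsto F (comap Complex.im atTop) (𝓝 c))
    (hd : ∀ᶠ τ in comap Complex.im atTop, DifferentiableAt ℂ F τ) : HasLeadingTerm F 0 c :=
  ⟨F, hF, hd.mono fun τ h ↦ ⟨h, by simp⟩⟩

theorem const (c : ℂ) : HasLeadingTerm (fun _ ↦ c) 0 c :=
  of_tendsto tendsto_const_nhds (Eventually.of_forall fun _ ↦ by fun_prop)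

theorem tendsto (h : HasLeadingTerm F 0 c) : Tendsto F (comap Complex.im atTop) (𝓝 c) := by
  obtain ⟨R, hR, h⟩ := h
  exact hR.congr' (h.mono fun τ hτ ↦ by simp [hτ.2])

theorem eventually_ne_zero (h : HasLeadingTerm F a c) (hc : c ≠ 0) :
    ∀ᶠ τ in comap Complex.im atTop, F τ ≠ 0 := by
  obtain ⟨R, hR, h⟩ := h
  filter_upwards [h, hR.eventually_ne hc] with τ hτ hne
  rw [hτ.2]
  exact mul_ne_zero (Complex.exp_ne_zero _) hne

theorem congr (h : HasLeadingTerm F a c) (hFG : F =ᶠ[comap Complex.im atTop] G) :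
    HasLeadingTerm G a c := by
  obtain ⟨R, hR, h⟩ := h
  refine ⟨R, hR, ?_⟩
  filter_upwards [h, hFG] with τ hτ he
  rw [← he]
  exact hτ

theorem add (hF : HasLeadingTerm F a c) (hG : HasLeadingTerm G a d) :
    HasLeadingTerm (fun τ ↦ F τ + G τ) a (c + d) := by
  obtain ⟨R, hR, hF⟩ := hF
  obtain ⟨S, hS, hG⟩ := hG
  refine ⟨fun τ ↦ R τ + S τ, hR.add hS, ?_⟩
  filter_upwards [hF, hG] with τ h1 h2
  exact ⟨h1.1.add h2.1, by rw [h1.2, h2.2]; ring⟩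

theorem mul (hF : HasLeadingTerm F a c) (hG : HasLeadingTerm G b d) :
    HasLeadingTerm (fun τ ↦ F τ * G τ) (a + b) (c * d) := by
  obtain ⟨R, hR, hF⟩ := hF
  obtain ⟨S, hS, hG⟩ := hG
  refine ⟨fun τ ↦ R τ * S τ, hR.mul hS, ?_⟩
  filter_upwards [hF, hG] with τ h1 h2
  exact ⟨h1.1.mul h2.1, by rw [h1.2, h2.2, add_mul, Complex.exp_add]; ring⟩

theorem pow (hF : HasLeadingTerm F a c) (n : ℕ) :
    HasLeadingTerm (fun τ ↦ F τ ^ n) (n * a) (c ^ n) := by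
  obtain ⟨R, hR, hF⟩ := hF
  refine ⟨fun τ ↦ R τ ^ n, hR.pow n, ?_⟩
  filter_upwards [hF] with τ h1
  exact ⟨h1.1.pow n, by rw [h1.2, mul_assoc, Complex.exp_nat_mul, mul_pow]⟩

theorem div (hF : HasLeadingTerm F a c) (hG : HasLeadingTerm G b d) (hd : d ≠ 0) :
    HasLeadingTerm (fun τ ↦ F τ / G τ) (a - b) (c / d) := by
  obtain ⟨R, hR, hF⟩ := hF
  obtain ⟨S, hS, hG⟩ := hG
  refine ⟨fun τ ↦ R τ / S τ, hR.div hS hd, ?_⟩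
  filter_upwards [hF, hG, hS.eventually_ne hd] with τ h1 h2 h3
  refine ⟨h1.1.div h2.1 h3, ?_⟩
  rw [h1.2, h2.2, sub_mul, Complex.exp_sub]
  have := Complex.exp_ne_zero (b * τ)
  field_simp

theorem deriv (hF : HasLeadingTerm F a c) : HasLeadingTerm (deriv F) a (a * c) := by
  obtain ⟨R, hR, hF⟩ := hF
  have hR' := tendsto_deriv_comap_im hR (hF.mono fun _ h ↦ h.1)
  refine ⟨fun τ ↦ a * R τ + _root_.deriv R τ, by simpa using (hR.const_mul a).add hR', ?_⟩
  filter_upwards [eventually_eventually_nhds_comap_im hF] with τ h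
  have hd : DifferentiableAt ℂ R τ := h.self_of_nhds.1
  have han : AnalyticAt ℂ R τ :=
    Complex.analyticAt_iff_eventually_differentiableAt.2 (h.mono fun _ h ↦ h.1)
  refine ⟨(hd.const_mul a).add han.deriv.differentiableAt, ?_⟩
  have he : F =ᶠ[𝓝 τ] fun τ ↦ Complex.exp (a * τ) * R τ := h.mono fun _ h ↦ h.2
  rw [he.deriv_eq]
  have h1 : HasDerivAt (fun τ ↦ Complex.exp (a * τ)) (Complex.exp (a * τ) * (a * 1)) τ :=
    ((hasDerivAt_id τ).const_mul a).cexp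
  refine (h1.mul hd.hasDerivAt).deriv.trans ?_
  ring

end HasLeadingTerm

theorem boundedAtFilter_burnsideX : BoundedAtFilter (comap Complex.im atTop) burnsideX := by
  refine Asymptotics.IsBigO.of_bound 2 ?_
  filter_upwards [tendsto_burnsideX_sq.norm.eventually
    (eventually_le_nhds (show ‖(1 : ℂ)‖ < 4 by norm_num))] with τ hτ
  rw [norm_pow] at hτ
  have := norm_nonneg (burnsideX τ)
  norm_num
  nlinarith

/-- The expansion of `x` at `i∞` in powers of `exp (2πiτ / 4)`. It is not constant because
`x ^ 2 ≠ 1` on the upper half plane. -/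
theorem exists_hasLeadingTerm_burnsideX_sub : ∃ s a ρ : ℂ, s ^ 2 = 1 ∧ a ≠ 0 ∧ ρ ≠ 0 ∧
    Tendsto burnsideX (comap Complex.im atTop) (𝓝 s) ∧
    HasLeadingTerm (fun τ ↦ burnsideX τ - s) a ρ := by
  have h4 : (0 : ℝ) < 4 := by norm_num
  have hper : Function.Periodic burnsideX (4 : ℝ) := fun τ ↦ by
    simpa using burnsideX_add_four τ
  have hhol : ∀ᶠ τ in comap Complex.im atTop, DifferentiableAt ℂ burnsideX τ :=
    eventually_comap_im_pos.mono fun τ h ↦ differentiableAt_burnsideX h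
  set φ := Function.Periodic.cuspFunction 4 burnsideX
  have hlim : Tendsto burnsideX (comap Complex.im atTop) (𝓝 (φ 0)) :=
    Function.Periodic.tendsto_at_I_inf h4 hper hhol boundedAtFilter_burnsideX
  have hφ0 := Function.Periodic.differentiableAt_cuspFunction_zero h4 hper hhol
    boundedAtFilter_burnsideX
  have hφ : AnalyticAt ℂ φ 0 := by
    rw [Complex.analyticAt_iff_eventually_differentiableAt, ← nhdsNE_sup_pure, eventually_sup]
    exact ⟨Function.Periodic.eventually_differentiableAt_cuspFunction_nhds_ne_zero h4 hper hhol,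
      hφ0⟩
  have hs : φ 0 ^ 2 = 1 := tendsto_nhds_unique (hlim.pow 2) tendsto_burnsideX_sq
  have hq := Function.Periodic.qParam_tendsto h4
  have hφx : ∀ τ, φ (Function.Periodic.qParam 4 τ) = burnsideX τ := fun τ ↦
    Function.Periodic.eq_cuspFunction h4.ne' hper τ
  have hnz : ¬ ∀ᶠ q in 𝓝 0, φ q - φ 0 = 0 := fun h ↦ by
    obtain ⟨τ, h1, h2⟩ := ((hq.eventually (h.filter_mono nhdsWithin_le_nhds)).and
      eventually_comap_im_pos).exists
    rw [hφx, sub_eq_zero] at h1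
    exact burnsideX_sq_ne_one h2.ne' (h1 ▸ hs)
  obtain ⟨k, g, hg, hg0, hk⟩ :=
    (hφ.sub analyticAt_const).exists_eventuallyEq_pow_smul_nonzero_iff.2 hnz
  have hk0 : k ≠ 0 := by
    rintro rfl
    have := hk.self_of_nhds
    simp at this
    exact hg0 (this.symm.trans (sub_self _))
  refine ⟨φ 0, k * (2 * Real.pi * Complex.I / 4), g 0, hs, ?_, hg0, hlim,
    fun τ ↦ g (Function.Periodic.qParam 4 τ), ?_, ?_⟩
  · simp [hk0]
  · exact hg.continuousAt.tendsto.comp (tendsto_nhds_of_tendsto_nhdsWithin hq)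
  · have hgd := Complex.analyticAt_iff_eventually_differentiableAt.1 hg
    filter_upwards [hq.eventually ((hgd.and hk).filter_mono nhdsWithin_le_nhds)] with τ hτ
    refine ⟨hτ.1.comp τ (Function.Periodic.differentiable_qParam τ), ?_⟩
    have := hτ.2
    simp only [Pi.sub_apply, hφx, sub_zero, smul_eq_mul] at this
    rw [this, mul_assoc, Complex.exp_nat_mul, Function.Periodic.qParam]
    congr 3
    push_cast
    ring

/-! ### Cusp forms of level one -/

open ModularGroup MatrixGroups ModularForm in
/-- Invariance under the generators `τ ↦ τ + 1` and `τ ↦ -1 / τ` makes a holomorphic function that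
vanishes at `i∞` a cusp form of level one. -/
theorem exists_cuspForm_of_transformation {F : ℂ → ℂ} {k : ℕ}
    (hd : DifferentiableOn ℂ F upperHalfPlaneSet)
    (hT : ∀ τ : ℂ, 0 < τ.im → F (τ + 1) = F τ)
    (hS : ∀ τ : ℂ, 0 < τ.im → F (-1 / τ) = τ ^ k * F τ)
    (h0 : Tendsto F (comap Complex.im atTop) (𝓝 0)) :
    ∃ f : CuspForm 𝒮ℒ k, ∀ z : ℍ, f z = F z := by
  have slash : ∀ γ : SL(2, ℤ), (fun z : ℍ ↦ F z) ∣[(k : ℤ)] γ = fun z : ℍ ↦ F z := by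
    refine SlashInvariantForm.slash_action_generators_SL2Z ?_ ?_
    · ext z
      rw [SL_slash_apply, UpperHalfPlane.modular_S_smul]
      have hden : denom S z = z := denom_S z
      have h := hS z z.im_pos
      rw [neg_div, one_div] at h
      rw [hden, coe_mk, neg_inv.symm, h, zpow_neg, zpow_natCast]
      have hz := ne_zero z
      field_simp
    · ext z
      have hden : denom T z = 1 := by
        rw [ModularGroup.denom_apply]
        simp [ModularGroup.T]
      rw [SL_slash_apply, hden, modular_T_smul, coe_vadd, one_zpow, mul_one, ← hT z z.im_pos,
        Complex.ofReal_one, add_comm]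
  refine ⟨{ toFun := fun z : ℍ ↦ F z, slash_action_eq' := ?_, holo' := ?_, zero_at_cusps' := ?_ },
    fun z ↦ rfl⟩
  · rintro _ ⟨γ, rfl⟩
    exact slash γ
  · rw [UpperHalfPlane.mdifferentiable_iff]
    refine hd.congr fun z hz ↦ ?_
    simp [ofComplex_apply_of_im_pos hz]
  · intro c hc
    rw [Subgroup.IsArithmetic.isCusp_iff_isCusp_SL2Z] at hc
    rw [OnePoint.isZeroAt_iff_forall_SL2Z hc]
    intro γ _
    rw [slash γ]
    exact h0.comp UpperHalfPlane.tendsto_coe_atImInfty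

open MatrixGroups in
theorem eq_zero_of_transformation_weight_four {F : ℂ → ℂ}
    (hd : DifferentiableOn ℂ F upperHalfPlaneSet)
    (hT : ∀ τ : ℂ, 0 < τ.im → F (τ + 1) = F τ)
    (hS : ∀ τ : ℂ, 0 < τ.im → F (-1 / τ) = τ ^ 4 * F τ)
    (h0 : Tendsto F (comap Complex.im atTop) (𝓝 0)) {τ : ℂ} (hτ : 0 < τ.im) : F τ = 0 := by
  obtain ⟨f, hf⟩ := exists_cuspForm_of_transformation (k := 4) hd hT hS h0
  have := rank_zero_iff_forall_zero.1
    (CuspForm.rank_eq_zero_of_weight_lt_twelve (k := ((4 : ℕ) : ℤ)) (by norm_num)) f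
  rw [← coe_mk τ hτ, ← hf, this]
  rfl

open MatrixGroups in
/-- A cusp form of weight twelve is a multiple of the discriminant, so it vanishes nowhere unless it
vanishes everywhere. -/
theorem ne_zero_of_transformation_weight_twelve {F : ℂ → ℂ}
    (hd : DifferentiableOn ℂ F upperHalfPlaneSet)
    (hT : ∀ τ : ℂ, 0 < τ.im → F (τ + 1) = F τ)
    (hS : ∀ τ : ℂ, 0 < τ.im → F (-1 / τ) = τ ^ 12 * F τ)
    (h0 : Tendsto F (comap Complex.im atTop) (𝓝 0)) (hne : ∃ σ : ℂ, 0 < σ.im ∧ F σ ≠ 0)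
    {τ : ℂ} (hτ : 0 < τ.im) : F τ ≠ 0 := by
  obtain ⟨f, hf⟩ := exists_cuspForm_of_transformation (k := 12) hd hT hS h0
  obtain ⟨c, hc⟩ := CuspForm.exists_smul_discriminant_of_weight_eq_twelve f
  have hfc : ∀ z : ℍ, F z = c * ModularForm.discriminant z := fun z ↦ by
    rw [← hf, ← hc]
    rfl
  obtain ⟨σ, hσ, hne⟩ := hne
  rw [← coe_mk σ hσ, hfc] at hne
  rw [← coe_mk τ hτ, hfc]
  exact mul_ne_zero (left_ne_zero_of_mul hne) (ModularForm.discriminant_ne_zero _)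

/-! ### Modular forms built from `x` -/

section
variable {F g : ℂ → ℂ} {τ : ℂ}

theorem deriv_add_one_of_forall_im_pos (h : ∀ τ : ℂ, 0 < τ.im → F (τ + 1) = g τ)
    (hτ : 0 < τ.im) : deriv F (τ + 1) = deriv g τ := by
  rw [← deriv_comp_add_const]
  refine EventuallyEq.deriv_eq ?_
  filter_upwards [isOpen_upperHalfPlaneSet.mem_nhds hτ] with w hw using h w hw

theorem deriv_neg_one_div_of_forall_im_pos (hF : DifferentiableAt ℂ F (-1 / τ))
    (h : ∀ τ : ℂ, 0 < τ.im → F (-1 / τ) = g τ) (hτ : 0 < τ.im) :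
    deriv F (-1 / τ) = τ ^ 2 * deriv g τ := by
  have h0 := ne_zero_of_im_pos hτ
  have h1 : HasDerivAt (fun τ : ℂ ↦ -1 / τ) (1 / τ ^ 2) τ := by
    have := (hasDerivAt_const τ (-1 : ℂ)).fun_div (hasDerivAt_id τ) h0
    simpa using this
  have h2 : HasDerivAt g (deriv F (-1 / τ) * (1 / τ ^ 2)) τ := by
    refine (hF.hasDerivAt.comp τ h1).congr_of_eventuallyEq ?_
    filter_upwards [isOpen_upperHalfPlaneSet.mem_nhds hτ] with w hw using (h w hw).symm
  rw [h2.deriv]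
  field_simp

end

/-- The function `x' ^ 6 / (x ^ 5 - x) ^ 2`, a multiple of the modular discriminant. -/
noncomputable def burnsideDelta (τ : ℂ) : ℂ :=
  deriv burnsideX τ ^ 6 / (burnsideX τ ^ 5 - burnsideX τ) ^ 2

/-- The function `(x ^ 8 + 14 x ^ 4 + 1) x' ^ 2 / (x ^ 5 - x) ^ 2`, a multiple of the Eisenstein
series of weight four. Its numerator is the invariant octic form of the octahedral group. -/
noncomputable def burnsideOctic (τ : ℂ) : ℂ :=
  (burnsideX τ ^ 8 + 14 * burnsideX τ ^ 4 + 1) * deriv burnsideX τ ^ 2 /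
    (burnsideX τ ^ 5 - burnsideX τ) ^ 2

section
variable {τ : ℂ}

theorem analyticAt_deriv_burnsideX (hτ : 0 < τ.im) : AnalyticAt ℂ (deriv burnsideX) τ :=
  (analyticAt_burnsideX hτ).deriv

theorem analyticAt_burnsideDelta (hτ : 0 < τ.im) : AnalyticAt ℂ burnsideDelta τ :=
  ((analyticAt_deriv_burnsideX hτ).pow 6).div
    ((((analyticAt_burnsideX hτ).pow 5).sub (analyticAt_burnsideX hτ)).pow 2)
    (pow_ne_zero 2 (burnsideX_pow_five_sub_ne_zero hτ.ne'))

theorem analyticAt_burnsideOctic (hτ : 0 < τ.im) : AnalyticAt ℂ burnsideOctic τ :=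
  (((((analyticAt_burnsideX hτ).pow 8).add
    (analyticAt_const.mul ((analyticAt_burnsideX hτ).pow 4))).add analyticAt_const).mul
      ((analyticAt_deriv_burnsideX hτ).pow 2)).div
    ((((analyticAt_burnsideX hτ).pow 5).sub (analyticAt_burnsideX hτ)).pow 2)
    (pow_ne_zero 2 (burnsideX_pow_five_sub_ne_zero hτ.ne'))

theorem deriv_burnsideX_add_one {ε : ℂ} (hε : ε ^ 2 = -1)
    (h : ∀ τ : ℂ, 0 < τ.im → burnsideX (τ + 1) = (burnsideX τ + ε) / (1 + ε * burnsideX τ))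
    (hτ : 0 < τ.im) :
    deriv burnsideX (τ + 1) = 2 * deriv burnsideX τ / (1 + ε * burnsideX τ) ^ 2 := by
  have hx := (differentiableAt_burnsideX hτ).hasDerivAt
  rw [deriv_add_one_of_forall_im_pos h hτ, ((hx.add_const ε).fun_div
    ((hx.const_mul ε).const_add 1) (one_add_mul_burnsideX_ne_zero hτ.ne' hε)).deriv]
  congr 1
  linear_combination -deriv burnsideX τ * hε

theorem deriv_burnsideX_neg_one_div (hτ : 0 < τ.im) :
    deriv burnsideX (-1 / τ) = τ ^ 2 * (-2 * deriv burnsideX τ / (burnsideX τ - 1) ^ 2) := by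
  have hx := (differentiableAt_burnsideX hτ).hasDerivAt
  rw [deriv_neg_one_div_of_forall_im_pos (differentiableAt_burnsideX (neg_one_div_im_pos hτ))
    (fun τ hτ ↦ burnsideX_neg_one_div hτ.ne') hτ, ((hx.add_const 1).fun_div
    (hx.sub_const 1) (burnsideX_sub_one_ne_zero hτ.ne')).deriv]
  congr 2
  ring

end

section
variable {x ε : ℂ}

/-- A rotation of the octahedron multiplies the form `x ^ 5 - x` of degree six, whose zeros are the
vertices, by a constant. -/
theorem mobius_pow_five_sub (hε : ε ^ 2 = -1) (h : 1 + ε * x ≠ 0) :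
    ((x + ε) / (1 + ε * x)) ^ 5 - (x + ε) / (1 + ε * x) =
      -8 * (x ^ 5 - x) / (1 + ε * x) ^ 6 := by
  have hε4 : ε ^ 4 = 1 := by linear_combination (ε ^ 2 - 1) * hε
  have hε5 : ε ^ 5 = ε := by linear_combination ε * hε4
  have hε6 : ε ^ 6 = -1 := by linear_combination ε ^ 2 * hε4 + hε
  obtain ⟨u, hu⟩ : ∃ u, u = 1 + ε * x := ⟨_, rfl⟩
  rw [← hu] at h ⊢
  field_simp
  rw [hu]
  ring_nf
  simp only [hε, hε4, hε5, hε6]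
  ring

/-- A rotation of the octahedron multiplies the invariant octic form by a constant. -/
theorem mobius_octic (hε : ε ^ 2 = -1) (h : 1 + ε * x ≠ 0) :
    ((x + ε) / (1 + ε * x)) ^ 8 + 14 * ((x + ε) / (1 + ε * x)) ^ 4 + 1 =
      16 * (x ^ 8 + 14 * x ^ 4 + 1) / (1 + ε * x) ^ 8 := by
  have hε3 : ε ^ 3 = -ε := by linear_combination ε * hε
  have hε4 : ε ^ 4 = 1 := by linear_combination (ε ^ 2 - 1) * hε
  have hε5 : ε ^ 5 = ε := by linear_combination ε * hε4
  have hε6 : ε ^ 6 = -1 := by linear_combination ε ^ 2 * hε4 + hε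
  have hε7 : ε ^ 7 = -ε := by linear_combination ε * hε6
  have hε8 : ε ^ 8 = 1 := by linear_combination (ε ^ 4 + 1) * hε4
  obtain ⟨u, hu⟩ : ∃ u, u = 1 + ε * x := ⟨_, rfl⟩
  rw [← hu] at h ⊢
  field_simp
  rw [hu]
  ring_nf
  simp only [hε, hε3, hε4, hε5, hε6, hε7, hε8]
  ring

end

section
variable {τ : ℂ}

theorem burnsideDelta_add_one (hτ : 0 < τ.im) : burnsideDelta (τ + 1) = burnsideDelta τ := by
  obtain ⟨ε, hε, h⟩ := exists_burnsideX_add_one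
  have h1 := one_add_mul_burnsideX_ne_zero hτ.ne' hε
  have h2 := burnsideX_pow_five_sub_ne_zero hτ.ne'
  rw [burnsideDelta, burnsideDelta, deriv_burnsideX_add_one hε h hτ, h τ hτ,
    mobius_pow_five_sub hε h1]
  generalize burnsideX τ ^ 5 - burnsideX τ = d at *
  field_simp
  ring

theorem burnsideOctic_add_one (hτ : 0 < τ.im) : burnsideOctic (τ + 1) = burnsideOctic τ := by
  obtain ⟨ε, hε, h⟩ := exists_burnsideX_add_one
  have h1 := one_add_mul_burnsideX_ne_zero hτ.ne' hε
  have h2 := burnsideX_pow_five_sub_ne_zero hτ.ne'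
  rw [burnsideOctic, burnsideOctic, deriv_burnsideX_add_one hε h hτ, h τ hτ,
    mobius_pow_five_sub hε h1, mobius_octic hε h1]
  generalize 1 + ε * burnsideX τ = u at *
  generalize burnsideX τ ^ 5 - burnsideX τ = d at *
  field_simp
  ring

theorem burnsideX_neg_one_div_pow_five_sub (hτ : 0 < τ.im) :
    burnsideX (-1 / τ) ^ 5 - burnsideX (-1 / τ) =
      8 * (burnsideX τ ^ 5 - burnsideX τ) / (burnsideX τ - 1) ^ 6 := by
  have h1 := burnsideX_sub_one_ne_zero hτ.ne'
  rw [burnsideX_neg_one_div hτ.ne']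
  field_simp
  ring

theorem burnsideDelta_neg_one_div (hτ : 0 < τ.im) :
    burnsideDelta (-1 / τ) = τ ^ 12 * burnsideDelta τ := by
  have h1 := burnsideX_sub_one_ne_zero hτ.ne'
  have h2 := burnsideX_pow_five_sub_ne_zero hτ.ne'
  rw [burnsideDelta, burnsideDelta, deriv_burnsideX_neg_one_div hτ,
    burnsideX_neg_one_div_pow_five_sub hτ]
  generalize burnsideX τ ^ 5 - burnsideX τ = d at *
  field_simp
  ring

theorem burnsideOctic_neg_one_div (hτ : 0 < τ.im) :
    burnsideOctic (-1 / τ) = τ ^ 4 * burnsideOctic τ := by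
  have h1 := burnsideX_sub_one_ne_zero hτ.ne'
  have h2 := burnsideX_pow_five_sub_ne_zero hτ.ne'
  have h3 : burnsideX (-1 / τ) ^ 8 + 14 * burnsideX (-1 / τ) ^ 4 + 1 =
      16 * (burnsideX τ ^ 8 + 14 * burnsideX τ ^ 4 + 1) / (burnsideX τ - 1) ^ 8 := by
    rw [burnsideX_neg_one_div hτ.ne']
    field_simp
    ring
  rw [burnsideOctic, burnsideOctic, deriv_burnsideX_neg_one_div hτ,
    burnsideX_neg_one_div_pow_five_sub hτ, h3]
  generalize burnsideX τ ^ 5 - burnsideX τ = d at *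
  field_simp
  ring

end

/-- The leading terms at `i∞` of the two modular forms built from `x`. -/
theorem exists_hasLeadingTerm_burnsideDelta : ∃ a c : ℂ, c ≠ 0 ∧
    HasLeadingTerm burnsideDelta (4 * a) c ∧ HasLeadingTerm burnsideOctic 0 (a ^ 2) ∧
    Tendsto burnsideDelta (comap Complex.im atTop) (𝓝 0) := by
  obtain ⟨s, a, ρ, hs, ha, hρ, hxlim, hxs⟩ := exists_hasLeadingTerm_burnsideX_sub
  have hd : ∀ᶠ τ in comap Complex.im atTop, DifferentiableAt ℂ burnsideX τ :=
    eventually_comap_im_pos.mono fun τ h ↦ differentiableAt_burnsideX h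
  have hx := HasLeadingTerm.of_tendsto hxlim hd
  have hD : HasLeadingTerm (deriv burnsideX) a (a * ρ) :=
    hxs.deriv.congr (Eventually.of_forall fun τ ↦ deriv_sub_const s)
  have hD0 := tendsto_deriv_comap_im hxlim hd
  have hf : HasLeadingTerm (fun τ ↦ burnsideX τ ^ 5 - burnsideX τ) a (4 * ρ) := by
    have := hxs.mul ((hx.mul (hx.add (.const s))).mul ((hx.pow 2).add
      (by simpa using HasLeadingTerm.const 1)))
    have e1 : ρ * (s * (s + s) * (s ^ 2 + 1)) = 4 * ρ := by
      rw [hs]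
      linear_combination 4 * ρ * hs
    rw [e1] at this
    simp only [Nat.cast_ofNat, mul_zero, add_zero] at this
    refine this.congr (Eventually.of_forall fun τ ↦ ?_)
    linear_combination (-burnsideX τ ^ 3 - burnsideX τ) * hs
  have hρ4 : (4 * ρ) ^ 2 ≠ 0 := by simpa using hρ
  refine ⟨a, (a * ρ) ^ 6 / (4 * ρ) ^ 2, by simp [ha, hρ], ?_, ?_, ?_⟩
  · have := (hD.pow 6).div (hf.pow 2) hρ4
    rwa [show ((6 : ℕ) : ℂ) * a - (2 : ℕ) * a = 4 * a by push_cast; ring] at this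
  · have h8 : HasLeadingTerm (fun τ ↦ burnsideX τ ^ 8 + 14 * burnsideX τ ^ 4 + 1) 0 16 := by
      refine .of_tendsto ?_ (hd.mono fun τ h ↦ by fun_prop)
      have h1 := ((hxlim.pow 8).add ((hxlim.pow 4).const_mul 14)).add_const 1
      rwa [show s ^ 8 + 14 * s ^ 4 + 1 = 16 by
        linear_combination (s ^ 6 + s ^ 4 + 15 * s ^ 2 + 15) * hs] at h1
    have := (h8.mul (hD.pow 2)).div (hf.pow 2) hρ4
    rw [show 0 + ((2 : ℕ) : ℂ) * a - (2 : ℕ) * a = 0 by ring,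
      show 16 * (a * ρ) ^ 2 / (4 * ρ) ^ 2 = a ^ 2 by field_simp; norm_num] at this
    exact this
  · have h1 := hD.div hf (by simpa using hρ)
    rw [sub_self] at h1
    have h2 := (hD0.pow 4).mul (h1.tendsto.pow 2)
    rw [zero_pow (by norm_num), zero_mul] at h2
    refine h2.congr fun τ ↦ ?_
    rw [burnsideDelta, div_pow, mul_div_assoc', ← pow_add]

section
variable {τ : ℂ}

/-- `x' ^ 6 / (x ^ 5 - x) ^ 2` is a nonzero cusp form of weight twelve and hence vanishes
nowhere. -/
theorem burnsideDelta_ne_zero (hτ : 0 < τ.im) : burnsideDelta τ ≠ 0 := by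
  obtain ⟨a, c, hc, hΔ, -, h0⟩ := exists_hasLeadingTerm_burnsideDelta
  obtain ⟨σ, hσ, hne⟩ := (eventually_comap_im_pos.and (hΔ.eventually_ne_zero hc)).exists
  exact ne_zero_of_transformation_weight_twelve
    (fun w hw ↦ (analyticAt_burnsideDelta hw).differentiableAt.differentiableWithinAt)
    (fun w hw ↦ burnsideDelta_add_one hw) (fun w hw ↦ burnsideDelta_neg_one_div hw) h0
    ⟨σ, hσ, hne⟩ hτ

theorem deriv_burnsideX_ne_zero (hτ : 0 < τ.im) : deriv burnsideX τ ≠ 0 := by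
  intro h
  apply burnsideDelta_ne_zero hτ
  simp [burnsideDelta, h]

theorem analyticAt_logDeriv_burnsideDelta (hτ : 0 < τ.im) :
    AnalyticAt ℂ (logDeriv burnsideDelta) τ :=
  (analyticAt_burnsideDelta hτ).deriv.div (analyticAt_burnsideDelta hτ) (burnsideDelta_ne_zero hτ)

theorem logDeriv_burnsideDelta_add_one (hτ : 0 < τ.im) :
    logDeriv burnsideDelta (τ + 1) = logDeriv burnsideDelta τ := by
  rw [logDeriv_apply, logDeriv_apply, burnsideDelta_add_one hτ,
    deriv_add_one_of_forall_im_pos (fun w hw ↦ burnsideDelta_add_one hw) hτ]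

theorem logDeriv_burnsideDelta_neg_one_div (hτ : 0 < τ.im) :
    logDeriv burnsideDelta (-1 / τ) = τ ^ 2 * logDeriv burnsideDelta τ + 12 * τ := by
  have h0 := ne_zero_of_im_pos hτ
  have hne := burnsideDelta_ne_zero hτ
  have hd : HasDerivAt (fun τ ↦ τ ^ 12 * burnsideDelta τ) _ τ :=
    (hasDerivAt_pow 12 τ).mul (analyticAt_burnsideDelta hτ).differentiableAt.hasDerivAt
  rw [logDeriv_apply, logDeriv_apply, burnsideDelta_neg_one_div hτ,
    deriv_neg_one_div_of_forall_im_pos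
      (analyticAt_burnsideDelta (neg_one_div_im_pos hτ)).differentiableAt
      (fun w hw ↦ burnsideDelta_neg_one_div hw) hτ, hd.deriv]
  push_cast
  field_simp
  ring

/-- The combination `L' - L ^ 2 / 12` of the logarithmic derivative `L` of a form of weight twelve
is modular of weight four. Its sum with the multiple of `burnsideOctic` that has the opposite value
at `i∞` vanishes, because there are no cusp forms of weight four. -/
theorem deriv_logDeriv_burnsideDelta (hτ : 0 < τ.im) :
    deriv (logDeriv burnsideDelta) τ - logDeriv burnsideDelta τ ^ 2 / 12 +
      4 / 3 * burnsideOctic τ = 0 := by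
  obtain ⟨a, c, hc, hΔ, hV, -⟩ := exists_hasLeadingTerm_burnsideDelta
  have hL : HasLeadingTerm (logDeriv burnsideDelta) 0 (4 * a) := by
    have := hΔ.deriv.div hΔ hc
    rwa [sub_self, mul_div_cancel_right₀ _ hc] at this
  refine eq_zero_of_transformation_weight_four (F := fun τ ↦ deriv (logDeriv burnsideDelta) τ -
    logDeriv burnsideDelta τ ^ 2 / 12 + 4 / 3 * burnsideOctic τ)
    (fun w hw ↦ ?_) (fun w hw ↦ ?_) (fun w hw ↦ ?_) ?_ hτ
  · have h1 := (analyticAt_logDeriv_burnsideDelta hw).deriv.differentiableAt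
    have h2 := (analyticAt_logDeriv_burnsideDelta hw).differentiableAt
    have h3 := (analyticAt_burnsideOctic hw).differentiableAt
    exact ((h1.sub ((h2.pow 2).div_const 12)).add (h3.const_mul _)).differentiableWithinAt
  · simp only [burnsideOctic_add_one hw, logDeriv_burnsideDelta_add_one hw,
      deriv_add_one_of_forall_im_pos (fun w hw ↦ logDeriv_burnsideDelta_add_one hw) hw]
  · have hd : HasDerivAt (fun τ ↦ τ ^ 2 * logDeriv burnsideDelta τ + 12 * τ) _ w :=
      ((hasDerivAt_pow 2 w).mul
        (analyticAt_logDeriv_burnsideDelta hw).differentiableAt.hasDerivAt).add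
        ((hasDerivAt_id w).const_mul 12)
    simp only [burnsideOctic_neg_one_div hw, logDeriv_burnsideDelta_neg_one_div hw,
      deriv_neg_one_div_of_forall_im_pos
        (analyticAt_logDeriv_burnsideDelta (neg_one_div_im_pos hw)).differentiableAt
        (fun w hw ↦ logDeriv_burnsideDelta_neg_one_div hw) hw, hd.deriv]
    push_cast
    ring
  · have := (hL.deriv.tendsto.sub ((hL.tendsto.pow 2).div_const 12)).add
      (hV.tendsto.const_mul (4 / 3))
    rwa [show 0 * (4 * a) - (4 * a) ^ 2 / 12 + 4 / 3 * a ^ 2 = 0 by ring] at this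

end

/-! ### The Schwarz equation -/

section
variable {τ : ℂ}

theorem logDeriv_burnsideDelta (hτ : 0 < τ.im) : logDeriv burnsideDelta τ =
    6 * (deriv (deriv burnsideX) τ / deriv burnsideX τ) -
      2 * ((5 * burnsideX τ ^ 4 - 1) * deriv burnsideX τ / (burnsideX τ ^ 5 - burnsideX τ)) := by
  have hx := (differentiableAt_burnsideX hτ).hasDerivAt
  have hD := (analyticAt_deriv_burnsideX hτ).differentiableAt.hasDerivAt
  have h1 := deriv_burnsideX_ne_zero hτ
  have h2 := burnsideX_pow_five_sub_ne_zero hτ.ne'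
  have h3 : HasDerivAt burnsideDelta _ τ :=
    (hD.fun_pow 6).fun_div (((hx.fun_pow 5).fun_sub hx).fun_pow 2) (pow_ne_zero 2 h2)
  rw [logDeriv_apply, h3.deriv, burnsideDelta]
  generalize burnsideX τ ^ 5 - burnsideX τ = d at *
  push_cast
  field_simp

/-- The Schwarz equation, with its right hand side over a common denominator. It is the relation of
weight four, with the logarithmic derivative of `x' ^ 6 / (x ^ 5 - x) ^ 2` written out. -/
theorem schwarzian_burnsideX (hτ : 0 < τ.im) :
    schwarzian burnsideX τ / deriv burnsideX τ ^ 2 =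
      -(1 / 2) * ((burnsideX τ ^ 8 + 14 * burnsideX τ ^ 4 + 1) /
        (burnsideX τ ^ 5 - burnsideX τ) ^ 2) := by
  have hx := (differentiableAt_burnsideX hτ).hasDerivAt
  have hD := (analyticAt_deriv_burnsideX hτ).differentiableAt.hasDerivAt
  have hD2 := (analyticAt_deriv_burnsideX hτ).deriv.differentiableAt.hasDerivAt
  have h1 := deriv_burnsideX_ne_zero hτ
  have h2 := burnsideX_pow_five_sub_ne_zero hτ.ne'
  have h3 : HasDerivAt (logDeriv burnsideDelta) _ τ :=
    (((hD2.fun_div hD h1).const_mul 6).fun_sub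
      ((((((hx.fun_pow 4).const_mul 5).sub_const 1).fun_mul hD).fun_div
        ((hx.fun_pow 5).fun_sub hx) h2).const_mul 2)).congr_of_eventuallyEq
      (by filter_upwards [isOpen_upperHalfPlaneSet.mem_nhds hτ] with w hw
          exact logDeriv_burnsideDelta hw)
  have key := deriv_logDeriv_burnsideDelta hτ
  rw [h3.deriv, logDeriv_burnsideDelta hτ, burnsideOctic] at key
  have e2 : iteratedDeriv 2 burnsideX = deriv (deriv burnsideX) := by
    rw [iteratedDeriv_succ, iteratedDeriv_one]
  have e3 : iteratedDeriv 3 burnsideX = deriv (deriv (deriv burnsideX)) := by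
    rw [iteratedDeriv_succ, e2]
  rw [schwarzian, e2, e3]
  obtain ⟨d, hd⟩ : ∃ d, d = burnsideX τ ^ 5 - burnsideX τ := ⟨_, rfl⟩
  rw [← hd] at key h2 ⊢
  generalize burnsideX τ = x at *
  generalize deriv (deriv (deriv burnsideX)) τ = x3 at *
  generalize deriv (deriv burnsideX) τ = x2 at *
  generalize deriv burnsideX τ = x1 at *
  push_cast at key
  field_simp at key ⊢
  -- With `f = x ^ 5 - x` and `P = x ^ 8 + 14 x ^ 4 + 1` this is `P - f' ^ 2 = -24 x ^ 3 f`.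
  linear_combination key / 108 + 40 / 3 * x1 ^ 4 * x ^ 3 * hd

end

section
variable {x : ℂ}

theorem sum_one_div_sq_sub (h : x ^ 5 - x ≠ 0) :
    1 / x ^ 2 + 1 / (x - 1) ^ 2 + 1 / (x + 1) ^ 2 + 1 / (x - Complex.I) ^ 2 +
      1 / (x + Complex.I) ^ 2 - 4 * x ^ 3 / (x ^ 5 - x) =
      (x ^ 8 + 14 * x ^ 4 + 1) / (x ^ 5 - x) ^ 2 := by
  have hI : Complex.I ^ 2 = -1 := Complex.I_sq
  have hfac : x ^ 5 - x = x * (x - 1) * (x + 1) * ((x - Complex.I) * (x + Complex.I)) := by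
    linear_combination (x ^ 3 - x) * hI
  rw [hfac] at h
  simp only [mul_ne_zero_iff] at h
  obtain ⟨⟨⟨h0, h1⟩, h2⟩, h3, h4⟩ := h
  have hq : x ^ 2 + 1 = (x - Complex.I) * (x + Complex.I) := by linear_combination hI
  have e : 1 / (x - Complex.I) ^ 2 + 1 / (x + Complex.I) ^ 2 =
      2 * (x ^ 2 - 1) / (x ^ 2 + 1) ^ 2 := by
    rw [hq]
    field_simp
    linear_combination 2 * hI
  have h5 : x ^ 2 + 1 ≠ 0 := hq ▸ mul_ne_zero h3 h4
  rw [add_assoc _ (1 / (x - Complex.I) ^ 2), e,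
    show x ^ 5 - x = x * (x - 1) * (x + 1) * (x ^ 2 + 1) by ring]
  field_simp
  ring

theorem notMem_of_pow_five_sub_ne_zero (h : x ^ 5 - x ≠ 0) :
    x ∉ ({0, 1, -1, Complex.I, -Complex.I} : Set ℂ) := by
  contrapose! h
  have hI : Complex.I ^ 5 = Complex.I := by
    linear_combination (Complex.I ^ 3 - Complex.I) * Complex.I_sq
  simp only [Set.mem_insert_iff, Set.mem_singleton_iff] at h
  rcases h with rfl | rfl | rfl | rfl | rfl
  · norm_num
  · norm_num
  · norm_num
  · rw [hI, sub_self]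
  · linear_combination -hI

end

theorem iteratedDeriv_burnsideX_neg (n : ℕ) (τ : ℂ) :
    iteratedDeriv n burnsideX (-τ) = (-1) ^ n * iteratedDeriv n burnsideX τ := by
  have h := iteratedDeriv_comp_neg n burnsideX τ
  simp only [burnsideX_neg] at h
  rw [show (fun τ ↦ burnsideX τ) = burnsideX from rfl] at h
  rw [h, smul_eq_mul, ← mul_assoc, ← mul_pow]
  norm_num

theorem deriv_burnsideX_neg (τ : ℂ) : deriv burnsideX (-τ) = -deriv burnsideX τ := by
  simpa using iteratedDeriv_burnsideX_neg 1 τ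

theorem schwarzian_burnsideX_neg (τ : ℂ) : schwarzian burnsideX (-τ) = schwarzian burnsideX τ := by
  rw [schwarzian, schwarzian, iteratedDeriv_burnsideX_neg, iteratedDeriv_burnsideX_neg,
    deriv_burnsideX_neg]
  ring

section
variable {τ : ℂ}

theorem schwarz_equation_burnsideX (h : τ.im ≠ 0) :
    AnalyticAt ℂ burnsideX τ ∧ deriv burnsideX τ ≠ 0 ∧
      schwarzian burnsideX τ / deriv burnsideX τ ^ 2 =
        -(1 / 2) * (1 / burnsideX τ ^ 2
          + 1 / (burnsideX τ - 1) ^ 2 + 1 / (burnsideX τ + 1) ^ 2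
          + 1 / (burnsideX τ - Complex.I) ^ 2 + 1 / (burnsideX τ + Complex.I) ^ 2
          - 4 * burnsideX τ ^ 3 / (burnsideX τ ^ 5 - burnsideX τ)) := by
  wlog hτ : 0 < τ.im generalizing τ
  · have hn : 0 < (-τ).im := by
      rw [Complex.neg_im]
      exact neg_pos.2 (lt_of_le_of_ne (not_lt.1 hτ) h)
    obtain ⟨h1, h2, h3⟩ := this hn.ne' hn
    rw [schwarzian_burnsideX_neg, deriv_burnsideX_neg, burnsideX_neg, neg_sq] at h3
    rw [deriv_burnsideX_neg, neg_ne_zero] at h2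
    refine ⟨?_, h2, h3⟩
    have := h1.comp_of_eq (f := fun τ ↦ -τ) (by fun_prop) rfl
    exact this.congr (Eventually.of_forall fun w ↦ burnsideX_neg w)
  rw [sum_one_div_sq_sub (burnsideX_pow_five_sub_ne_zero h)]
  exact ⟨analyticAt_burnsideX hτ, deriv_burnsideX_ne_zero hτ, schwarzian_burnsideX hτ⟩

end

/-- A polynomial of degree at most two vanishing along `x` is zero: the derivative of `x` does not
vanish, so the derivatives of the polynomial also vanish along `x`. -/
theorem eq_zero_of_quadratic_burnsideX_eq_zero {A₁ A₂ A₃ : ℂ}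
    (h : ∀ τ : ℂ, 0 < τ.im → A₁ * burnsideX τ ^ 2 + A₂ * burnsideX τ + A₃ = 0) :
    A₁ = 0 ∧ A₂ = 0 ∧ A₃ = 0 := by
  have hderiv : ∀ {F : ℂ → ℂ} {F' τ : ℂ}, (∀ τ : ℂ, 0 < τ.im → F τ = 0) → 0 < τ.im →
      HasDerivAt F F' τ → F' = 0 := fun {F F' τ} hF hτ hd ↦
    hd.unique ((hasDerivAt_const τ 0).congr_of_eventuallyEq
      (by filter_upwards [isOpen_upperHalfPlaneSet.mem_nhds hτ] with w hw using hF w hw))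
  have h1 : ∀ τ : ℂ, 0 < τ.im → A₁ * (2 * burnsideX τ) + A₂ = 0 := fun τ hτ ↦ by
    have hx := (differentiableAt_burnsideX hτ).hasDerivAt
    have := hderiv h hτ ((((hx.fun_pow 2).const_mul A₁).fun_add (hx.const_mul A₂)).add_const A₃)
    refine (mul_eq_zero.1 ?_).resolve_right (deriv_burnsideX_ne_zero hτ)
    rw [← this]
    push_cast
    ring
  have hI : 0 < Complex.I.im := by simp
  have hA₁ : A₁ = 0 := by
    have hx := (differentiableAt_burnsideX hI).hasDerivAt
    have := hderiv h1 hI (((hx.const_mul 2).const_mul A₁).add_const A₂)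
    simpa [deriv_burnsideX_ne_zero hI] using this
  have hA₂ : A₂ = 0 := by simpa [hA₁] using h1 Complex.I hI
  exact ⟨hA₁, hA₂, by simpa [hA₁, hA₂] using h Complex.I hI⟩

theorem proposition1 :
    (∀ τ : ℂ, τ.im ≠ 0 →
      burnsideP τ τ ≠ burnsideP τ 2 ∧
      AnalyticAt ℂ burnsideX τ ∧
      deriv burnsideX τ ≠ 0 ∧
      burnsideX τ ∉ ({0, 1, -1, Complex.I, -Complex.I} : Set ℂ) ∧
      schwarzian burnsideX τ / deriv burnsideX τ ^ 2 =
        -(1 / 2) * (1 / burnsideX τ ^ 2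
          + 1 / (burnsideX τ - 1) ^ 2 + 1 / (burnsideX τ + 1) ^ 2
          + 1 / (burnsideX τ - Complex.I) ^ 2 + 1 / (burnsideX τ + Complex.I) ^ 2
          - 4 * burnsideX τ ^ 3 / (burnsideX τ ^ 5 - burnsideX τ))) ∧
    (∀ A₁ A₂ A₃ : ℂ,
      (∀ τ : ℂ, 0 < τ.im →
        schwarzian burnsideX τ / deriv burnsideX τ ^ 2 = burnsideQ A₁ A₂ A₃ (burnsideX τ)) ↔
      A₁ = 0 ∧ A₂ = 0 ∧ A₃ = 0) := by
  refine ⟨fun τ h ↦ ?_, fun A₁ A₂ A₃ ↦ ?_⟩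
  · obtain ⟨h1, h2, h3⟩ := schwarz_equation_burnsideX h
    exact ⟨burnsideP_self_ne h, h1, h2,
      notMem_of_pow_five_sub_ne_zero (burnsideX_pow_five_sub_ne_zero h), h3⟩
  · constructor
    · intro H
      refine eq_zero_of_quadratic_burnsideX_eq_zero fun τ hτ ↦ ?_
      have hne := burnsideX_pow_five_sub_ne_zero hτ.ne'
      have h1 := H τ hτ
      rw [(schwarz_equation_burnsideX hτ.ne').2.2, burnsideQ, add_div] at h1
      have h2 : (A₁ * burnsideX τ ^ 2 + A₂ * burnsideX τ + A₃) /
          (burnsideX τ ^ 5 - burnsideX τ) = 0 := by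
        linear_combination -2 * h1
      exact (div_eq_zero_iff.1 h2).resolve_right hne
    · rintro ⟨rfl, rfl, rfl⟩ τ hτ
      rw [(schwarz_equation_burnsideX hτ.ne').2.2, burnsideQ]
      simp
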